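/- Let $\mathbb T=\mathbb R/2\pi\mathbb Z$ and $A=-\partial_{xx}$. All functions and distributions on $\mathbb T$ are real-valued with spatial mean zero; $e^{-tA}$ ($t\ge 0$) and $A^\delta$ ($\delta\in\mathbb R$) are defined by the spectral decomposition of $A$, i.e. they multiply the Fourier coefficient $\hat u(k)$, $k\in\mathbb Z\setminus\{0\}$, by $e^{-tk^2}$ and $|k|^{2\delta}$. The space of these distributions carries the $\sigma$-algebra generated by the Fourier coefficients. For $\gamma\in\mathbb R$, $\mathcal C^\gamma$ is the closure of the smooth functions in the norm of the Besov space $B^\gamma_{\infty,\infty}(\mathbb T)$, $\|u\|=\sup_{j\ge -1}2^{j\gamma}\|\Delta_j u\|_{L^\infty}$, where $\Delta_j$ are the Littlewood–Paley blocks of a smooth dyadic partition of unity. Let $W$ be a cylindrical Brownian motion on $L^2(\mathbb T)$, let $\beta\in\mathbb R$, and let $\Xi$ be a linear operator, mapping real functions to real functions, with $\Xi\approx A^{\beta/2}$: $A$ and $\Xi$ have a common orthonormal eigenbasis (its elements may be complex-valued) and $A^{-\beta}\,\Xi\Xi^*$ is bounded with bounded inverse. For a deterministic initial condition $z_0$ let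 $$z_t=e^{-tA}z_0+\int_0^t e^{-(t-s)A}\,\Xi\,dW_s$$ be the mild solution of $(\partial_t+A)z_t=\Xi\,dW_t$. Let $(\mathcal G_t)_{t\ge0}$ be a filtration independent of $W$, let $F$ be a distribution-valued stochastic process, continuous in time, and suppose that $$h_t=\int_0^t e^{-(t-s)A}F_s\,ds$$ is adapted to $(\mathcal G_t)$. Fix $t>0$. If $\|A^{\frac{1-\beta}{2}}h_t\|_{L^2}<\infty$ almost surely, then almost surely the random measure $\mathrm{Law}(z_t+h_t\mid\mathcal G_t)$, given by $\mathrm{Law}(z_t+h_t\mid\mathcal G_t)(B)=\mathbb E(\mathbf 1_B(z_t+h_t)\mid\mathcal G_t)$, is equivalent (mutually absolutely continuous) to $\mathrm{Law}(z_t)$. In particular, if $h_t\in\mathcal C^\gamma$ almost surely for some $\gamma\in\mathbb R$ with $\gamma+\beta>1$, then $\|A^{\frac{1-\beta}{2}}h_t\|_{L^2}<\infty$ almost surely and the same conclusion holds. -/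

import Mathlib

open MeasureTheory ProbabilityTheory Filter Topology
open scoped NNReal ENNReal ComplexConjugate

noncomputable section

namespace CameronMartin

/-! ## Functions and distributions on the torus `ℝ / 2πℤ` -/

/-- The torus `𝕋 = [0, 2π]` with periodic boundary conditions. -/
abbrev Torus : Type := AddCircle (2 * Real.pi)

instance instFactTwoPi : Fact (0 < 2 * Real.pi) := ⟨Real.two_pi_pos⟩

/-- The real Hilbert space `L²(𝕋)` (Lebesgue measure, total mass `2π`). -/
abbrev L2Torus : Type := Lp ℝ 2 (volume : Measure Torus)

/-- Nonzero frequencies; the zero frequency is absent since everything has mean zero in space. -/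
abbrev Mode : Type := {k : ℤ // k ≠ 0}

instance instNegMode : Neg Mode := ⟨fun k => ⟨-k.1, neg_ne_zero.2 k.2⟩⟩

/-- The eigenvalue `k²` of `A = -∂ₓₓ` on `x ↦ e^{ikx}`. -/
def eig (k : Mode) : ℝ := (k.1 : ℝ) ^ 2

lemma one_le_abs_mode (k : Mode) : 1 ≤ |(k.1 : ℝ)| := by
  have := Int.one_le_abs k.2
  exact_mod_cast this

lemma eig_nonneg (k : Mode) : 0 ≤ eig k := sq_nonneg _

lemma eig_neg (k : Mode) : eig (-k) = eig k := by
  have h : ((-k : Mode)).1 = -k.1 := rfl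
  simp [eig, h]

/-- Real-valued mean-zero distributions on `𝕋`, given by their Fourier series
`u = ∑_{k ≠ 0} û(k) e^{ikx}`, `û(k) = (2π)⁻¹ ∫ u(x) e^{-ikx} dx`: a family of numbers is the family
of Fourier coefficients of a periodic distribution exactly if it grows at most polynomially, and
the distribution is real exactly if `û(-k)` is the conjugate of `û(k)`. -/
@[ext]
structure Distr where
  coeff : Mode → ℂ
  real : ∀ k, coeff (-k) = conj (coeff k)
  growth : ∃ (C : ℝ) (N : ℕ), ∀ k, ‖coeff k‖ ≤ C * (1 + |(k.1 : ℝ)|) ^ N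

namespace Distr

/-- The σ-algebra on distributions generated by the Fourier coefficients. -/
instance : MeasurableSpace Distr := MeasurableSpace.comap Distr.coeff inferInstance

instance : Add Distr := ⟨fun u v =>
  { coeff := fun k => u.coeff k + v.coeff k
    real := fun k => by simp [u.real, v.real]
    growth := by
      obtain ⟨C, N, hC⟩ := u.growth
      obtain ⟨D, M, hD⟩ := v.growth
      refine ⟨|C| + |D|, N + M, fun k => (norm_add_le _ _).trans ?_⟩
      have hb : 1 ≤ 1 + |(k.1 : ℝ)| := by linarith [abs_nonneg (k.1 : ℝ)]
      have h1 : (1 + |(k.1 : ℝ)|) ^ N ≤ (1 + |(k.1 : ℝ)|) ^ (N + M) :=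
        pow_le_pow_right₀ hb (by omega)
      have h2 : (1 + |(k.1 : ℝ)|) ^ M ≤ (1 + |(k.1 : ℝ)|) ^ (N + M) :=
        pow_le_pow_right₀ hb (by omega)
      have h3 : C * (1 + |(k.1 : ℝ)|) ^ N ≤ |C| * (1 + |(k.1 : ℝ)|) ^ (N + M) :=
        mul_le_mul (le_abs_self C) h1 (by positivity) (abs_nonneg C)
      have h4 : D * (1 + |(k.1 : ℝ)|) ^ M ≤ |D| * (1 + |(k.1 : ℝ)|) ^ (N + M) :=
        mul_le_mul (le_abs_self D) h2 (by positivity) (abs_nonneg D)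
      linarith [hC k, hD k] }⟩

instance : Neg Distr := ⟨fun u =>
  { coeff := fun k => -u.coeff k
    real := fun k => by simp [u.real]
    growth := by
      obtain ⟨C, N, hC⟩ := u.growth
      exact ⟨C, N, fun k => by simpa using hC k⟩ }⟩

instance : Sub Distr := ⟨fun u v => u + -v⟩

/-- Fourier multiplier with a real even symbol of polynomial growth. -/
def multiplier (m : Mode → ℝ) (heven : ∀ k, m (-k) = m k)
    (hm : ∃ (C : ℝ) (N : ℕ), ∀ k, |m k| ≤ C * (1 + |(k.1 : ℝ)|) ^ N) (u : Distr) : Distr where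
  coeff k := (m k : ℂ) * u.coeff k
  real k := by simp [u.real, heven]
  growth := by
    obtain ⟨C, N, hC⟩ := u.growth
    obtain ⟨D, M, hD⟩ := hm
    refine ⟨D * C, M + N, fun k => ?_⟩
    have h1 : ‖(m k : ℂ) * u.coeff k‖ = |m k| * ‖u.coeff k‖ := by simp
    rw [h1]
    calc |m k| * ‖u.coeff k‖
        ≤ (D * (1 + |(k.1 : ℝ)|) ^ M) * (C * (1 + |(k.1 : ℝ)|) ^ N) :=
          mul_le_mul (hD k) (hC k) (norm_nonneg _) ((abs_nonneg _).trans (hD k))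
      _ = D * C * (1 + |(k.1 : ℝ)|) ^ (M + N) := by ring

/-- The operator `A^δ`, `A = -∂ₓₓ`, defined by the spectral decomposition. -/
def powA (δ : ℝ) : Distr → Distr :=
  multiplier (fun k => eig k ^ δ) (fun k => by rw [eig_neg]) (by
    obtain ⟨N, hN⟩ := exists_nat_ge (2 * δ)
    refine ⟨1, N, fun k => ?_⟩
    have h1 := one_le_abs_mode k
    have h0 : (0 : ℝ) ≤ |(k.1 : ℝ)| := abs_nonneg _
    have h2 : eig k ^ δ = |(k.1 : ℝ)| ^ (2 * δ) := by
      rw [Real.rpow_mul h0, eig, ← sq_abs]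
      norm_num
    rw [h2, abs_of_nonneg (Real.rpow_nonneg h0 _), one_mul]
    calc |(k.1 : ℝ)| ^ (2 * δ) ≤ |(k.1 : ℝ)| ^ (N : ℝ) := Real.rpow_le_rpow_of_exponent_le h1 hN
      _ = |(k.1 : ℝ)| ^ N := Real.rpow_natCast _ _
      _ ≤ (1 + |(k.1 : ℝ)|) ^ N := pow_le_pow_left₀ h0 (by linarith) N)

/-- The heat semigroup `e^{-rA}`, `r ≥ 0`. -/
def heat (r : ℝ≥0) : Distr → Distr :=
  multiplier (fun k => Real.exp (-(r : ℝ) * eig k)) (fun k => by rw [eig_neg]) (by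
    refine ⟨1, 0, fun k => ?_⟩
    have := mul_nonneg r.coe_nonneg (eig_nonneg k)
    rw [abs_of_pos (Real.exp_pos _)]
    simpa using this)

/-- `u` is (the Fourier series of) a square integrable function, that is, `‖u‖_{L²} < ∞`. -/
def MemL2 (u : Distr) : Prop :=
  ∃ f : Lp ℂ 2 (AddCircle.haarAddCircle : Measure Torus),
    fourierCoeff f 0 = 0 ∧ ∀ k : Mode, fourierCoeff f k.1 = u.coeff k

/-- `u` is a smooth function: its Fourier coefficients decay faster than any power. -/
def IsSmooth (u : Distr) : Prop :=
  ∀ N : ℕ, ∃ C : ℝ, ∀ k, (1 + |(k.1 : ℝ)|) ^ N * ‖u.coeff k‖ ≤ C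

end Distr

/-! ## Besov–Hölder spaces -/

/-- The symbols `φ₋₁ = χ`, `φ_j = φ(2^{-j} ·)` for `j ≥ 0`, with the index shifted by one. -/
def dyadicSymbol (χ φ : ℝ → ℝ) : ℕ → ℝ → ℝ
  | 0 => χ
  | j + 1 => fun ξ => φ ((2 : ℝ) ^ (-(j : ℝ)) * ξ)

/-- A dyadic partition of unity: smooth radial `χ` supported in a ball and `φ` supported in an
annulus. -/
structure DyadicPartition where
  χ : ℝ → ℝ
  φ : ℝ → ℝ
  smooth_χ : ContDiff ℝ (⊤ : ℕ∞) χ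
  smooth_φ : ContDiff ℝ (⊤ : ℕ∞) φ
  even_χ : ∀ ξ, χ (-ξ) = χ ξ
  even_φ : ∀ ξ, φ (-ξ) = φ ξ
  χ_mem : ∀ ξ, χ ξ ∈ Set.Icc (0 : ℝ) 1
  φ_mem : ∀ ξ, φ ξ ∈ Set.Icc (0 : ℝ) 1
  partition : ∀ ξ, HasSum (fun j : ℕ => φ ((2 : ℝ) ^ (-(j : ℝ)) * ξ)) (1 - χ ξ)
  support_χ : ∃ R : ℝ, 0 < R ∧ tsupport χ ⊆ {ξ | |ξ| ≤ R}
  support_φ : ∃ a b : ℝ, 0 < a ∧ a < b ∧ tsupport φ ⊆ {ξ | a ≤ |ξ| ∧ |ξ| ≤ b}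
  disjoint : ∀ i j : ℕ, i + 1 < j →
    Disjoint (tsupport (dyadicSymbol χ φ i)) (tsupport (dyadicSymbol χ φ j))

/-- The Littlewood–Paley block `Δ_{n-1} u`, a trigonometric polynomial. -/
def block (D : DyadicPartition) (n : ℕ) (u : Distr) (x : Torus) : ℂ :=
  ∑' k : Mode, ((dyadicSymbol D.χ D.φ n (k.1 : ℝ) : ℝ) : ℂ) * u.coeff k * fourier k.1 x

/-- The norm of `B^γ_{∞,∞}(𝕋)`: the supremum over `j = n - 1 ≥ -1` of
`2^{jγ} ‖Δ_j u‖_{L^∞}`. -/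
def besovNorm (D : DyadicPartition) (γ : ℝ) (u : Distr) : ℝ≥0∞ :=
  ⨆ (n : ℕ) (x : Torus),
    ENNReal.ofReal ((2 : ℝ) ^ (((n : ℝ) - 1) * γ) * ‖block D n u x‖)

/-- `u ∈ 𝒞^γ`, the closure of the smooth functions in the norm of `B^γ_{∞,∞}(𝕋)`. -/
def MemHolder (D : DyadicPartition) (γ : ℝ) (u : Distr) : Prop :=
  ∀ ε : ℝ≥0∞, 0 < ε → ∃ g : Distr, g.IsSmooth ∧ besovNorm D γ (u - g) < ε

/-! ## Trigonometric polynomials and the operator in front of the noise -/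

/-- Complex mean-zero trigonometric polynomials `∑_{k ≠ 0} p(k) e^{ikx}`. -/
abbrev TrigPoly : Type := Mode →₀ ℂ

namespace TrigPoly

/-- The `L²` inner product `∫ conj(p(x)) q(x) dx = 2π ∑ conj(p(k)) q(k)`. -/
def inner2 (p q : TrigPoly) : ℂ := 2 * Real.pi * q.sum fun k c => conj (p k) * c

/-- The `L²` norm. -/
def norm2 (p : TrigPoly) : ℝ := Real.sqrt (inner2 p p).re

/-- `q` is the complex conjugate function of `p`. -/
def IsConj (p q : TrigPoly) : Prop := ∀ k, q (-k) = conj (p k)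

/-- `p` is a real-valued function. -/
def IsReal (p : TrigPoly) : Prop := IsConj p p

/-- Fourier multiplier. -/
def multiplier (m : Mode → ℝ) : TrigPoly →ₗ[ℂ] TrigPoly :=
  Finsupp.linearCombination ℂ fun k => Finsupp.single k (m k : ℂ)

lemma multiplier_apply (m : Mode → ℝ) (p : TrigPoly) (k : Mode) :
    multiplier m p k = m k * p k := by
  classical
  rw [multiplier, Finsupp.linearCombination_apply, Finsupp.sum, Finsupp.finsetSum_apply]
  by_cases hk : k ∈ p.support
  · rw [Finset.sum_eq_single k]
    · simp [mul_comm]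
    · intro b _ hb
      simp [hb]
    · exact fun h => absurd hk h
  · rw [Finset.sum_eq_zero, Finsupp.notMem_support_iff.1 hk, mul_zero]
    intro b hb
    have : b ≠ k := fun h => hk (h ▸ hb)
    simp [this]

/-- `A^δ` on trigonometric polynomials. -/
def powA (δ : ℝ) : TrigPoly →ₗ[ℂ] TrigPoly := multiplier fun k => eig k ^ δ

/-- `e^{-rA}` on trigonometric polynomials. -/
def heat (r : ℝ≥0) : TrigPoly →ₗ[ℂ] TrigPoly := multiplier fun k => Real.exp (-(r : ℝ) * eig k)

/-- A trigonometric polynomial as an element of the real space `L²(𝕋)` (used for real ones). -/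
def toL2 (p : TrigPoly) : L2Torus :=
  ContinuousMap.toLp 2 volume ℝ
    ⟨fun x : Torus => (∑ k ∈ p.support, p k * fourier k.1 x).re, by fun_prop⟩

/-- A bounded operator (with respect to the `L²` norm). -/
def IsBounded (T : TrigPoly →ₗ[ℂ] TrigPoly) : Prop := ∃ C : ℝ, ∀ p, norm2 (T p) ≤ C * norm2 p

end TrigPoly

/-- The duality pairing `⟨u, p⟩ = ∫ u(x) p(x) dx` of a real distribution with a real trigonometric
polynomial. -/
def Distr.pair (u : Distr) (p : TrigPoly) : ℝ :=
  (2 * Real.pi * p.sum fun k c => u.coeff k * conj c).re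

/-- A (possibly unbounded) linear operator `Ξ` on mean-zero functions together with its `L²`
adjoint `Ξ*`, both given on the trigonometric polynomials; `Ξ` maps real functions to real
functions. An operator that has an eigenbasis in common with `A` maps each of the
finite-dimensional eigenspaces of `A` to itself, so it does act on trigonometric polynomials. -/
structure NoiseOperator where
  op : TrigPoly →ₗ[ℂ] TrigPoly
  adj : TrigPoly →ₗ[ℂ] TrigPoly
  adj_spec : ∀ p q, TrigPoly.inner2 (op p) q = TrigPoly.inner2 p (adj q)
  real : ∀ p q, TrigPoly.IsConj p q → TrigPoly.IsConj (op p) (op q)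

/-- `A` and `Ξ` have a common orthonormal eigenbasis. Eigenvectors of `A` are trigonometric
polynomials, and an orthonormal Hilbert basis of eigenvectors of `A` is the same as an orthonormal
algebraic basis of the trigonometric polynomials that consists of such eigenvectors.
Complex-valued eigenfunctions are allowed, as they are needed for `Ξ = ∂ₓ`. -/
def NoiseOperator.CommonEigenbasis (Ξ : NoiseOperator) : Prop :=
  ∃ (e : Module.Basis ℕ ℂ TrigPoly) (l : ℕ → ℝ) (σ : ℕ → ℂ),
    (∀ i j, TrigPoly.inner2 (e i) (e j) = if i = j then 1 else 0) ∧
    (∀ i, TrigPoly.powA 1 (e i) = (l i : ℂ) • e i) ∧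
    (∀ i, Ξ.op (e i) = σ i • e i)

/-- `Ξ ≈ A^{β/2}`: `A` and `Ξ` have a common eigenbasis and `A^{-β} Ξ Ξ*` is bounded with bounded
inverse. -/
def NoiseOperator.ApproxPower (Ξ : NoiseOperator) (β : ℝ) : Prop :=
  Ξ.CommonEigenbasis ∧
  ∃ S : TrigPoly →ₗ[ℂ] TrigPoly,
    (TrigPoly.powA (-β) ∘ₗ Ξ.op ∘ₗ Ξ.adj) ∘ₗ S = LinearMap.id ∧
    S ∘ₗ (TrigPoly.powA (-β) ∘ₗ Ξ.op ∘ₗ Ξ.adj) = LinearMap.id ∧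
    TrigPoly.IsBounded (TrigPoly.powA (-β) ∘ₗ Ξ.op ∘ₗ Ξ.adj) ∧
    TrigPoly.IsBounded S

/-! ## Cylindrical Brownian motion and the stochastic convolution -/

section Probability

variable {Ω : Type*} [MeasurableSpace Ω]

/-- A cylindrical Brownian motion on a real Hilbert space `H`: a centered Gaussian family
`W_t(φ)`, `t ≥ 0`, `φ ∈ H`, with covariance `E[W_s(φ) W_t(ψ)] = (s ∧ t) ⟨φ, ψ⟩`, such that
`t ↦ W_t(φ)` has almost surely continuous paths for every `φ`. -/
structure IsCylindricalBrownianMotion {H : Type*} [NormedAddCommGroup H] [InnerProductSpace ℝ H]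
    (W : ℝ≥0 → H → Ω → ℝ) (P : Measure Ω) : Prop where
  measurable : ∀ s φ, Measurable (W s φ)
  gaussian : IsGaussianProcess (fun (q : ℝ≥0 × H) => W q.1 q.2) P
  mean_zero : ∀ s φ, ∫ ω, W s φ ω ∂P = 0
  covariance : ∀ s t φ ψ, ∫ ω, W s φ ω * W t ψ ω ∂P = (min s t : ℝ≥0) * inner ℝ φ ψ
  continuous : ∀ φ, ∀ᵐ ω ∂P, Continuous fun s => W s φ ω

/-- The σ-algebra generated by the whole forcing `W`. -/
abbrev sigmaNoise {H : Type*} (W : ℝ≥0 → H → Ω → ℝ) : MeasurableSpace Ω :=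
  ⨆ (s : ℝ≥0) (φ : H), MeasurableSpace.comap (W s φ) inferInstance

/-- The Itô sum `∑_{i < n} (W_{(i+1)t/n} - W_{it/n})(f(it/n))`. -/
def itoSum {H : Type*} (W : ℝ≥0 → H → Ω → ℝ) (f : ℝ≥0 → H) (t : ℝ≥0) (n : ℕ) (ω : Ω) : ℝ :=
  ∑ i ∈ Finset.range n,
    (W (((i : ℝ≥0) + 1) * t / n) (f ((i : ℝ≥0) * t / n)) ω
      - W ((i : ℝ≥0) * t / n) (f ((i : ℝ≥0) * t / n)) ω)

/-- `X = ∫_0^t ⟨f(s), dW_s⟩` for a deterministic continuous integrand `f : [0, t] → H`: `X` is the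
limit in `L²(P)` of the Itô sums. -/
def IsStochasticIntegral {H : Type*} (W : ℝ≥0 → H → Ω → ℝ) (P : Measure Ω) (f : ℝ≥0 → H)
    (t : ℝ≥0) (X : Ω → ℝ) : Prop :=
  Tendsto (fun n => eLpNorm (fun ω => X ω - itoSum W f t n ω) 2 P) atTop (𝓝 0)

/-- `z` is the mild solution `z_t = e^{-tA} z₀ + ∫_0^t e^{-(t-s)A} Ξ dW_s` of
`(∂_t + A) z_t = Ξ dW_t` with initial condition `z₀`, the stochastic integral being read against
real trigonometric polynomials: `⟨∫_0^t e^{-(t-s)A} Ξ dW_s, p⟩ = ∫_0^t ⟨Ξ* e^{-(t-s)A} p, dW_s⟩`. -/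
structure IsStochasticConvolution (P : Measure Ω) (W : ℝ≥0 → L2Torus → Ω → ℝ)
    (Ξ : NoiseOperator) (z₀ : Distr) (z : ℝ≥0 → Ω → Distr) : Prop where
  measurable : ∀ t, Measurable (z t)
  mild : ∀ t (p : TrigPoly), p.IsReal →
    IsStochasticIntegral W P (fun s => (Ξ.adj (TrigPoly.heat (t - s) p)).toL2) t
      (fun ω => (z t ω).pair p - (z₀.heat t).pair p)

/-- `h_t = ∫_0^t e^{-(t-s)A} F_s ds` (an integral of distributions, read in each Fourier
coefficient). -/
def IsDriftIntegral (F : ℝ≥0 → Distr) (t : ℝ≥0) (h : Distr) : Prop :=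
  ∀ k, h.coeff k = ∫ s in (0 : ℝ)..t, ((F s.toNNReal).heat (t - s.toNNReal)).coeff k

end Probability

/-- `κ` is (a regular version of) the random measure `Law(X ∣ m)`, which satisfies
`Law(X ∣ m)(B) = E(1_B(X) ∣ m)` almost surely for every measurable set `B`. -/
structure IsCondLaw {Ω E : Type*} (m : MeasurableSpace Ω) [mΩ : MeasurableSpace Ω]
    [MeasurableSpace E] (P : Measure Ω) (X : Ω → E) (κ : Ω → Measure E) : Prop where
  prob : ∀ ω, IsProbabilityMeasure (κ ω)
  measurable : ∀ B, MeasurableSet B → Measurable[m] fun ω => κ ω B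
  condExp : ∀ B, MeasurableSet B →
    (fun ω => (κ ω B).toReal) =ᵐ[P] P[(X ⁻¹' B).indicator (fun _ => (1 : ℝ)) | m]

/-- `Law(X ∣ m)` exists and is almost surely equivalent (mutually absolutely continuous) to `ν`. -/
def CondLawEquivalent {Ω E : Type*} (m : MeasurableSpace Ω) [mΩ : MeasurableSpace Ω]
    [MeasurableSpace E] (P : Measure Ω) (X : Ω → E) (ν : Measure E) : Prop :=
  (∃ κ, IsCondLaw m P X κ) ∧
  ∀ κ, IsCondLaw m P X κ → ∀ᵐ ω ∂P, κ ω ≪ ν ∧ ν ≪ κ ω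

end CameronMartin

end

/-!
Fix `t > 0` and let `μ` be the law of `z_t`. The σ-algebra `𝒢 t` is independent of the noise, `z_t`
is almost surely a function of the noise, and `h_t` is `𝒢 t`-measurable, so by the freezing lemma
(`isCondLaw_of_indepFun`) the conditional law of `z_t + h_t` given `𝒢 t` is the law of `z_t + h`
evaluated at `h = h_t`. It remains to show that `μ` and its shift by a *deterministic* `h` with
`A^{(1-β)/2} h ∈ L²` are equivalent, which is `map_add_equivalent`.

This is the Cameron–Martin theorem. Tested against real trigonometric polynomials `p`, the
stochastic convolution is a linear family `Z p` of centered Gaussian variables, as `L²` limits of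
Itô sums. By the Itô isometry and the coercivity of `Ξ Ξ*` (`NoiseOperator.ApproxPower.coercive`),
the variance of `Z p` is at least a multiple of
`∫_0^t ‖A^{β/2} e^{-sA} p‖² ds`, hence of `‖A^{(β-1)/2} p‖²` (`exists_wsq_le_norm_sq`). By
Cauchy–Schwarz, `p ↦ ⟨h, p⟩` is therefore bounded with respect to the `L²(P)` norm of `Z p`, and the
Riesz theorem yields a Gaussian variable `X` in the closed span of the family with
`E[X Z p] = ⟨h, p⟩`. Tilting `P` by `e^X` shifts each `Z p` by `⟨h, p⟩`
(`exists_tilted_eq_shift`); since characteristic functionals determine measures on distributions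
(`Distr.measure_ext`), the law of `z_t` under the tilted measure is the law of `z_t + h` under `P`.
A tilted measure is equivalent to the original one, and so are the image measures. Only a lower bound
for the covariance is needed, so the covariance operator never has to be computed.

For the second part, Parseval's identity for each Littlewood–Paley block shows that
`B^γ_{∞,∞}` embeds into `H^a` for every `a < γ`
(`DyadicPartition.summable_of_besovNorm_ne_top`), applied with `a = 1 - β`.
-/

namespace CameronMartin

/-! ### Trigonometric polynomials and Parseval's identity -/

lemma integral_normSq_sum_fourier (s : Finset Mode) (c : Mode → ℂ) :
    ∫ x : Torus, ‖∑ k ∈ s, c k * fourier k.1 x‖ ^ 2 = 2 * Real.pi * ∑ k ∈ s, ‖c k‖ ^ 2 := by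
  classical
  have h1 : ∀ x : Torus, ((‖∑ k ∈ s, c k * fourier k.1 x‖ ^ 2 : ℝ) : ℂ)
      = ∑ k ∈ s, ∑ l ∈ s, conj (c k) * c l * fourier (l.1 - k.1) x := by
    intro x
    rw [Complex.ofReal_pow, ← Complex.conj_mul', map_sum, Finset.sum_mul_sum]
    refine Finset.sum_congr rfl fun k _ => Finset.sum_congr rfl fun l _ => ?_
    rw [sub_eq_neg_add, fourier_add, fourier_neg, map_mul]
    ring
  have h2 : ∀ n : ℤ, ∫ x : Torus, (fourier n x : ℂ) = if n = 0 then (2 * Real.pi : ℂ) else 0 := by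
    intro n
    have h3 : ∫ x : Torus, (fourier n x : ℂ)
        = (2 * Real.pi : ℝ) •
          ∫ x, (fourier n x : ℂ) ∂(AddCircle.haarAddCircle : Measure Torus) := by
      rw [AddCircle.integral_haarAddCircle, smul_inv_smul₀ Real.two_pi_pos.ne']
    rw [h3]
    have h4 := orthonormal_iff_ite.1 (orthonormal_fourier (T := 2 * Real.pi)) 0 n
    rw [ContinuousMap.inner_toLp (AddCircle.haarAddCircle : Measure Torus) (fourier 0)
      (fourier n)] at h4
    simp only [fourier_zero, map_one, mul_one] at h4
    rw [h4]
    by_cases hn : n = 0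
    · simp [hn]
    · simp [hn, Ne.symm hn]
  have hint : ∀ f : C(Torus, ℂ), Integrable (fun x => f x) (volume : Measure Torus) := fun f =>
    integrableOn_univ.1 (f.continuous.continuousOn.integrableOn_compact isCompact_univ)
  have h5 : ((∫ x : Torus, ‖∑ k ∈ s, c k * fourier k.1 x‖ ^ 2 : ℝ) : ℂ)
      = ((2 * Real.pi * ∑ k ∈ s, ‖c k‖ ^ 2 : ℝ) : ℂ) := by
    rw [← integral_complex_ofReal]
    simp_rw [h1]
    rw [integral_finsetSum _ fun k _ => integrable_finsetSum _ fun l _ => (hint _).const_mul _]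
    push_cast
    rw [Finset.mul_sum]
    refine Finset.sum_congr rfl fun k hk => ?_
    rw [integral_finsetSum _ fun l _ => (hint _).const_mul _, Finset.sum_eq_single k]
    · rw [integral_const_mul, h2, if_pos (sub_self _), Complex.conj_mul']
      ring
    · intro l _ hl
      rw [integral_const_mul, h2, if_neg, mul_zero]
      exact sub_ne_zero.2 fun h => hl (Subtype.ext h)
    · exact fun h => absurd hk h
  exact_mod_cast h5

/-- The reflection `k ↦ -k` of the frequencies. -/
def negEquiv : Mode ≃ Mode where
  toFun k := -k
  invFun k := -k
  left_inv k := Subtype.ext (neg_neg k.1)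
  right_inv k := Subtype.ext (neg_neg k.1)

lemma mode_neg_neg (k : Mode) : - -k = k := negEquiv.left_inv k

lemma one_le_eig (k : Mode) : 1 ≤ eig k := by
  rw [eig, ← sq_abs]
  exact one_le_pow₀ (one_le_abs_mode k)

lemma eig_pos (k : Mode) : 0 < eig k := one_pos.trans_le (one_le_eig k)

namespace TrigPoly

lemma inner2_eq_tsum (p q : TrigPoly) : inner2 p q = 2 * Real.pi * ∑' k, conj (p k) * q k := by
  rw [inner2, Finsupp.sum, tsum_eq_sum]
  intro k hk
  rw [Finsupp.notMem_support_iff.1 hk, mul_zero]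

lemma inner2_conj_symm (p q : TrigPoly) : conj (inner2 p q) = inner2 q p := by
  rw [inner2_eq_tsum, inner2_eq_tsum, map_mul, Complex.conj_tsum]
  simp [mul_comm, Complex.conj_ofNat]

lemma inner2_add_right (p q r : TrigPoly) : inner2 p (q + r) = inner2 p q + inner2 p r := by
  simp only [inner2]
  rw [Finsupp.sum_add_index' (by simp) (by intros; ring)]
  ring

lemma inner2_smul_right (p q : TrigPoly) (a : ℂ) : inner2 p (a • q) = a * inner2 p q := by
  simp only [inner2]
  rw [Finsupp.sum_smul_index' (by simp)]
  simp only [Finsupp.sum, Finset.mul_sum, smul_eq_mul]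
  refine Finset.sum_congr rfl fun k _ => by ring

/-- The `L²` inner product as a linear functional of its second argument. -/
noncomputable def innerRight (p : TrigPoly) : TrigPoly →ₗ[ℂ] ℂ where
  toFun := inner2 p
  map_add' := inner2_add_right p
  map_smul' a q := inner2_smul_right p q a

lemma inner2_sum_right {ι : Type*} (s : Finset ι) (p : TrigPoly) (f : ι → TrigPoly) :
    inner2 p (∑ i ∈ s, f i) = ∑ i ∈ s, inner2 p (f i) :=
  map_sum (innerRight p) f s

lemma inner2_smul_left (p q : TrigPoly) (a : ℂ) : inner2 (a • p) q = conj a * inner2 p q := by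
  rw [← inner2_conj_symm, inner2_smul_right, map_mul, inner2_conj_symm]

lemma inner2_single (k : Mode) (q : TrigPoly) :
    inner2 (Finsupp.single k 1) q = 2 * Real.pi * q k := by
  classical
  rw [inner2_eq_tsum, tsum_eq_single k]
  · simp
  · intro l hl
    simp [Finsupp.single_eq_of_ne hl]

lemma inner2_isConj {p p' q q' : TrigPoly} (hp : IsConj p p') (hq : IsConj q q') :
    inner2 p' q' = conj (inner2 p q) := by
  rw [inner2_eq_tsum, inner2_eq_tsum, map_mul, Complex.conj_tsum, ← negEquiv.tsum_eq]
  congr 1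
  · simp [Complex.conj_ofNat]
  · refine tsum_congr fun k => ?_
    change conj (p' (-k)) * q' (-k) = _
    rw [hp k, hq k, map_mul]

/-- The squared norm `∑ w(k) |p(k)|²` with weight `w` on the Fourier side. -/
noncomputable def wsq (w : Mode → ℝ) (p : TrigPoly) : ℝ := ∑ k ∈ p.support, w k * ‖p k‖ ^ 2

lemma wsq_eq_sum {w : Mode → ℝ} {p : TrigPoly} {s : Finset Mode} (hs : p.support ⊆ s) :
    wsq w p = ∑ k ∈ s, w k * ‖p k‖ ^ 2 :=
  Finset.sum_subset hs fun k _ hk => by simp [Finsupp.notMem_support_iff.1 hk]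

lemma support_multiplier_subset (m : Mode → ℝ) (p : TrigPoly) :
    (multiplier m p).support ⊆ p.support := by
  intro k hk
  rw [Finsupp.mem_support_iff, multiplier_apply] at hk
  exact Finsupp.mem_support_iff.2 (right_ne_zero_of_mul hk)

lemma inner2_multiplier (w : Mode → ℝ) (p : TrigPoly) :
    inner2 p (multiplier w p) = ((2 * Real.pi * wsq w p : ℝ) : ℂ) := by
  rw [inner2, Finsupp.sum_of_support_subset _ (support_multiplier_subset w p) _ (by simp), wsq]
  push_cast
  congr 1
  refine Finset.sum_congr rfl fun k _ => ?_
  rw [multiplier_apply, ← Complex.conj_mul']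
  ring

lemma inner2_self (p : TrigPoly) : inner2 p p = ((2 * Real.pi * wsq 1 p : ℝ) : ℂ) := by
  rw [← inner2_multiplier]
  congr 1
  ext k
  simp [multiplier_apply]

/-- The real part in `toL2` loses nothing for a real-valued trigonometric polynomial. -/
lemma norm_toL2_sq {p : TrigPoly} (hp : p.IsReal) : ‖p.toL2‖ ^ 2 = 2 * Real.pi * wsq 1 p := by
  have hreal : ∀ x : Torus, (∑ k ∈ p.support, p k * fourier k.1 x : ℂ).im = 0 := by
    intro x
    rw [← Complex.conj_eq_iff_im, map_sum]
    have e : ∀ f : Mode → ℂ, (∀ k, p k = 0 → f k = 0) → ∑ k ∈ p.support, f k = ∑' k, f k :=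
      fun f hf => (tsum_eq_sum fun k hk => hf k (Finsupp.notMem_support_iff.1 hk)).symm
    rw [e _ (fun k hk => by simp [hk]), e _ (fun k hk => by simp [hk]), ← negEquiv.tsum_eq]
    refine tsum_congr fun k => ?_
    change conj (p (-k) * fourier (-k.1) x) = _
    rw [map_mul, hp k, fourier_neg]
    simp
  have h1 : ‖p.toL2‖ ^ 2 = ∫ x : Torus, ((∑ k ∈ p.support, p k * fourier k.1 x : ℂ).re) ^ 2 := by
    rw [← real_inner_self_eq_norm_sq, toL2,
      ContinuousMap.inner_toLp (𝕜 := ℝ) (volume : Measure Torus)]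
    simp [sq]
  rw [h1]
  have h2 := integral_normSq_sum_fourier p.support p
  simp only [wsq, Pi.one_apply, one_mul]
  rw [← h2]
  refine integral_congr_ae (.of_forall fun x => ?_)
  simp only []
  rw [← Complex.normSq_eq_norm_sq, Complex.normSq_apply, hreal x]
  ring

lemma isReal_heat {p : TrigPoly} (hp : p.IsReal) (r : ℝ≥0) : (heat r p).IsReal := by
  intro k
  rw [heat, multiplier_apply, multiplier_apply, hp k, eig_neg, map_mul, Complex.conj_ofReal]

end TrigPoly

namespace NoiseOperator

open TrigPoly

variable (Ξ : NoiseOperator)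

/-- The adjoint inherits from `Ξ` that it maps real functions to real functions. -/
lemma isReal_adj {q : TrigPoly} (hq : q.IsReal) : (Ξ.adj q).IsReal := by
  intro k
  have hs : TrigPoly.IsConj (Finsupp.single k 1) (Finsupp.single (-k) 1) := by
    classical
    intro l
    have : -k = -l ↔ k = l := negEquiv.injective.eq_iff
    by_cases h : k = l
    · simp [h]
    · rw [Finsupp.single_eq_of_ne (fun h' => h (this.1 h'.symm)),
        Finsupp.single_eq_of_ne (Ne.symm h)]
      simp
  have h1 := inner2_isConj (Ξ.real _ _ hs) hq
  rw [Ξ.adj_spec, Ξ.adj_spec, inner2_single, inner2_single, map_mul] at h1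
  have hpi : (2 * Real.pi : ℂ) ≠ 0 := by exact_mod_cast Real.two_pi_pos.ne'
  have h2 : conj (2 * Real.pi : ℂ) = 2 * Real.pi := by simp [Complex.conj_ofNat]
  rw [h2] at h1
  exact mul_left_cancel₀ hpi h1

/-- Coercivity of the noise: `‖Ξ* q‖²` dominates `‖A^{β/2} q‖²`. In the common eigenbasis both
sides are diagonal, and the bounded inverse of `A^{-β} Ξ Ξ*` compares the eigenvalues. -/
lemma ApproxPower.coercive {Ξ : NoiseOperator} {β : ℝ} (hΞ : Ξ.ApproxPower β) :
    ∃ C : ℝ, 0 < C ∧ ∀ q : TrigPoly, wsq (fun k => eig k ^ β) q ≤ C * wsq 1 (Ξ.adj q) := by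
  obtain ⟨⟨e, l, σ, hon, hl, hσ⟩, S, -, hS, -, C, hC⟩ := hΞ
  have hrepr : ∀ j x, inner2 (e j) x = e.repr x j := by
    intro j x
    conv_lhs => rw [← e.linearCombination_repr x, Finsupp.linearCombination_apply, Finsupp.sum,
      inner2_sum_right]
    simp only [inner2_smul_right, hon]
    simpa using Eq.symm
  have hadj : ∀ i, Ξ.adj (e i) = conj (σ i) • e i := by
    intro i
    refine e.repr.injective (Finsupp.ext fun j => ?_)
    rw [← hrepr, ← hrepr, ← Ξ.adj_spec, hσ, inner2_smul_left, inner2_smul_right, hon]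
    by_cases h : j = i <;> simp [h]
  have heig : ∀ i k, e i k ≠ 0 → eig k = l i := by
    intro i k hk
    have h := DFunLike.congr_fun (hl i) k
    rw [powA, multiplier_apply, Real.rpow_one, Finsupp.smul_apply, smul_eq_mul] at h
    exact_mod_cast mul_right_cancel₀ hk h
  have hpow : ∀ δ i, powA δ (e i) = ((l i ^ δ : ℝ) : ℂ) • e i := by
    intro δ i
    ext k
    rw [powA, multiplier_apply, Finsupp.smul_apply, smul_eq_mul]
    by_cases hk : e i k = 0
    · simp [hk]
    · rw [heig i k hk]
  have hlpos : ∀ i, 0 < l i := by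
    intro i
    obtain ⟨k, hk⟩ := Finsupp.ne_iff.1 (e.ne_zero i)
    rw [← heig i k hk]
    exact eig_pos k
  have hnorm : ∀ (a : ℂ) i, norm2 (a • e i) = ‖a‖ := by
    intro a i
    rw [norm2, inner2_smul_left, inner2_smul_right, hon, if_pos rfl, mul_one, Complex.conj_mul']
    norm_cast
    exact Real.sqrt_sq (norm_nonneg a)
  have hbound : ∀ i, l i ^ β ≤ C * ‖σ i‖ ^ 2 := by
    intro i
    have h1 := hC ((powA (-β) ∘ₗ Ξ.op ∘ₗ Ξ.adj) (e i))
    rw [← LinearMap.comp_apply S, hS] at h1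
    simp only [LinearMap.comp_apply, LinearMap.id_apply, hadj, map_smul, hσ, hpow] at h1
    rw [smul_smul, smul_smul, hnorm] at h1
    have h2 := hnorm 1 i
    rw [one_smul, norm_one] at h2
    rw [h2, norm_mul, norm_mul, Complex.norm_real, RCLike.norm_conj,
      Real.norm_of_nonneg (Real.rpow_nonneg (hlpos i).le _), Real.rpow_neg (hlpos i).le] at h1
    have h3 := Real.rpow_pos_of_pos (hlpos i) β
    have h4 := mul_le_mul_of_nonneg_left h1 h3.le
    calc l i ^ β = l i ^ β * 1 := (mul_one _).symm
      _ ≤ _ := h4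
      _ = C * ‖σ i‖ ^ 2 := by field_simp
  have hC0 : 0 < C := by
    by_contra h
    have := hbound 0
    have h3 := Real.rpow_pos_of_pos (hlpos 0) β
    nlinarith [sq_nonneg ‖σ 0‖]
  refine ⟨C, hC0, fun q => ?_⟩
  set s := (e.repr q).support
  have hq : q = ∑ i ∈ s, e.repr q i • e i := by
    conv_lhs => rw [← e.linearCombination_repr q, Finsupp.linearCombination_apply, Finsupp.sum]
  -- both quadratic forms are diagonal in the basis `e`
  have hdiag : ∀ (T : TrigPoly →ₗ[ℂ] TrigPoly) (a : ℕ → ℂ), (∀ i, T (e i) = a i • e i) →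
      inner2 q (T q) = ∑ i ∈ s, a i * (‖e.repr q i‖ ^ 2 : ℝ) := by
    intro T a ha
    conv_lhs => rw [hq, map_sum, inner2_sum_right]
    refine Finset.sum_congr rfl fun i _ => ?_
    rw [← hq, map_smul, ha, inner2_smul_right, inner2_smul_right, ← inner2_conj_symm, hrepr]
    push_cast
    rw [← Complex.mul_conj']
    ring
  have h1 := hdiag (powA β) _ (hpow β)
  have h2 := hdiag (Ξ.op ∘ₗ Ξ.adj) (fun i => ((‖σ i‖ ^ 2 : ℝ) : ℂ)) (fun i => by
    simp only [LinearMap.comp_apply, hadj, map_smul, hσ, smul_smul]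
    rw [Complex.conj_mul']
    push_cast
    rfl)
  rw [powA, inner2_multiplier] at h1
  rw [LinearMap.comp_apply, ← inner2_conj_symm, Ξ.adj_spec, inner2_self, Complex.conj_ofReal] at h2
  norm_cast at h1 h2
  have h5 : 2 * Real.pi * wsq (fun k => eig k ^ β) q
      ≤ C * (2 * Real.pi * wsq 1 (Ξ.adj q)) := by
    rw [h1, h2, Finset.mul_sum]
    refine Finset.sum_le_sum fun i _ => ?_
    rw [← mul_assoc]
    exact mul_le_mul_of_nonneg_right (hbound i) (sq_nonneg _)
  nlinarith [Real.two_pi_pos]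

end NoiseOperator

/-! ### Gaussian Hilbert spaces and the Cameron–Martin shift -/

section GaussianSpace

variable {Ω : Type*} [MeasurableSpace Ω] {P : Measure Ω}

/-- An element of `L²(P)` that is a centered Gaussian random variable; its variance is then the
square of its norm. -/
def IsCentered (X : Lp ℝ 2 P) : Prop := P.map X = gaussianReal 0 (‖X‖₊ ^ 2)

lemma integral_sq_eq_norm_sq (X : Lp ℝ 2 P) : ∫ ω, X ω ^ 2 ∂P = ‖X‖ ^ 2 := by
  rw [← real_inner_self_eq_norm_sq, L2.inner_def]
  simp [sq]

lemma aemeasurable_coe (X : Lp ℝ 2 P) : AEMeasurable X P := (Lp.aestronglyMeasurable X).aemeasurable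

lemma isCentered_toLp {Y : Ω → ℝ} (hY : HasGaussianLaw Y P) (h0 : ∫ ω, Y ω ∂P = 0) :
    IsCentered (hY.memLp_two.toLp Y) := by
  have h1 := hY.memLp_two.coeFn_toLp
  rw [IsCentered, Measure.map_congr h1, hY.map_eq_gaussianReal, h0]
  congr 1
  have h2 : Var[Y; P] = ‖hY.memLp_two.toLp Y‖ ^ 2 := by
    rw [variance_of_integral_eq_zero hY.aemeasurable h0, ← integral_sq_eq_norm_sq]
    exact integral_congr_ae (h1.mono fun ω h => by simp [h])
  rw [h2]
  rw [Real.toNNReal_pow (norm_nonneg _), norm_toNNReal]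

lemma coe_smul_add_smul (a b : ℝ) (X Y : Lp ℝ 2 P) :
    (a • X + b • Y : Lp ℝ 2 P) =ᵐ[P] fun ω => a * X ω + b * Y ω := by
  filter_upwards [Lp.coeFn_add (a • X) (b • Y), Lp.coeFn_smul a X, Lp.coeFn_smul b Y]
    with ω h1 h2 h3
  rw [h1, Pi.add_apply, h2, h3]
  rfl

/-- A linear family of square integrable random variables as a linear map into `L²(P)`. -/
noncomputable def toLpLinear {E : Type*} [AddCommMonoid E] [Module ℝ E] (Z : E →ₗ[ℝ] Ω → ℝ)
    (h : ∀ p, MemLp (Z p) 2 P) : E →ₗ[ℝ] Lp ℝ 2 P where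
  toFun p := (h p).toLp _
  map_add' p q := by
    rw [← MemLp.toLp_add]
    congr 1
    exact Z.map_add p q
  map_smul' a p := by
    rw [RingHom.id_apply, ← MemLp.toLp_const_smul]
    congr 1
    exact Z.map_smul a p

variable [IsProbabilityMeasure P]

lemma isCentered_iff (X : Lp ℝ 2 P) :
    IsCentered X ↔ ∀ s : ℝ, ∫ ω, Complex.exp (s * X ω * Complex.I) ∂P
      = Complex.exp (-(‖X‖ ^ 2 * s ^ 2 / 2 : ℝ)) := by
  have h : ∀ s : ℝ, charFun (P.map X) s = ∫ ω, Complex.exp (s * X ω * Complex.I) ∂P := by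
    intro s
    rw [charFun_apply_real, integral_map (aemeasurable_coe X) (by fun_prop)]
  have h2 : ∀ s : ℝ, charFun (gaussianReal 0 (‖X‖₊ ^ 2)) s
      = Complex.exp (-(‖X‖ ^ 2 * s ^ 2 / 2 : ℝ)) := by
    intro s
    rw [charFun_gaussianReal]
    congr 1
    push_cast
    simp
  have := Measure.isProbabilityMeasure_map (aemeasurable_coe X)
  constructor
  · intro hX s
    rw [← h, ← h2, hX]
  · intro hX
    refine Measure.ext_of_charFun (funext fun s => ?_)
    rw [h, h2, hX]

/-- Limits in `L²` of centered Gaussian variables are centered Gaussian. -/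
lemma isClosed_isCentered : IsClosed {X : Lp ℝ 2 P | IsCentered X} := by
  refine IsSeqClosed.isClosed fun Y X hY hYX => ?_
  rw [Set.mem_ofPred_eq, isCentered_iff]
  intro s
  obtain ⟨ns, hns, hae⟩ := (tendstoInMeasure_of_tendsto_Lp hYX).exists_seq_tendsto_ae
  have h1 : Tendsto (fun i => ∫ ω, Complex.exp (s * Y (ns i) ω * Complex.I) ∂P) atTop
      (𝓝 (∫ ω, Complex.exp (s * X ω * Complex.I) ∂P)) := by
    refine tendsto_integral_of_dominated_convergence (fun _ => 1) (fun i => ?_)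
      (integrable_const _) (fun i => .of_forall fun ω => ?_) ?_
    · have := aemeasurable_coe (Y (ns i))
      exact AEMeasurable.aestronglyMeasurable (by fun_prop)
    · rw [← Complex.ofReal_mul, Complex.norm_exp_ofReal_mul_I]
    · filter_upwards [hae] with ω hω
      have : Continuous fun x : ℝ => Complex.exp (s * x * Complex.I) := by fun_prop
      exact (this.tendsto _).comp hω
  have h2 : Tendsto (fun i => Complex.exp (-(‖Y (ns i)‖ ^ 2 * s ^ 2 / 2 : ℝ))) atTop
      (𝓝 (Complex.exp (-(‖X‖ ^ 2 * s ^ 2 / 2 : ℝ)))) := by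
    have : Continuous fun x : Lp ℝ 2 P => Complex.exp (-(‖x‖ ^ 2 * s ^ 2 / 2 : ℝ)) := by fun_prop
    exact (this.tendsto X).comp (hYX.comp hns.tendsto_atTop)
  refine tendsto_nhds_unique h1 (h2.congr fun i => ?_)
  exact ((isCentered_iff _).1 (hY (ns i)) s).symm

/-- Orthogonal elements of a Gaussian Hilbert space are independent. -/
lemma indepFun_of_inner_eq_zero {X Y : Lp ℝ 2 P} (h : ∀ a b : ℝ, IsCentered (a • X + b • Y))
    (h0 : inner ℝ X Y = 0) : IndepFun X Y P := by
  have hX := aemeasurable_coe X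
  have hY := aemeasurable_coe Y
  have key : ∀ a b : ℝ, ∫ ω, Complex.exp ((a * X ω + b * Y ω : ℝ) * Complex.I) ∂P
      = Complex.exp (-((‖X‖ ^ 2 * a ^ 2 + ‖Y‖ ^ 2 * b ^ 2) / 2 : ℝ)) := by
    intro a b
    have h1 := (isCentered_iff _).1 (h a b) 1
    have h2 : ‖a • X + b • Y‖ ^ 2 = ‖X‖ ^ 2 * a ^ 2 + ‖Y‖ ^ 2 * b ^ 2 := by
      rw [norm_add_sq_real, real_inner_smul_left, real_inner_smul_right, h0, norm_smul, norm_smul,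
        mul_pow, mul_pow, Real.norm_eq_abs, Real.norm_eq_abs, sq_abs, sq_abs]
      ring
    rw [h2] at h1
    simp only [one_pow, mul_one] at h1
    rw [← h1]
    refine integral_congr_ae ((coe_smul_add_smul a b X Y).mono fun ω hω => ?_)
    simp only [hω, Complex.ofReal_one, one_mul]
  rw [indepFun_iff_charFun_prod hX hY]
  intro s
  have e1 : charFun (P.map X) s.fst
      = ∫ ω, Complex.exp ((s.fst * X ω + 0 * Y ω : ℝ) * Complex.I) ∂P := by
    rw [charFun_apply_real, integral_map hX (by fun_prop)]
    simp
  have e2 : charFun (P.map Y) s.snd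
      = ∫ ω, Complex.exp ((0 * X ω + s.snd * Y ω : ℝ) * Complex.I) ∂P := by
    rw [charFun_apply_real, integral_map hY (by fun_prop)]
    simp
  have e3 : charFun (P.map fun ω => WithLp.toLp 2 (X ω, Y ω)) s
      = ∫ ω, Complex.exp ((s.fst * X ω + s.snd * Y ω : ℝ) * Complex.I) ∂P := by
    rw [charFun_apply, integral_map (by fun_prop) (by fun_prop)]
    refine integral_congr_ae (.of_forall fun ω => ?_)
    simp [WithLp.prod_inner_apply, mul_comm]
  change _ = charFun (P.map X) s.fst * charFun (P.map Y) s.snd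
  rw [e1, e2, e3, key, key, key, ← Complex.exp_add]
  congr 1
  push_cast
  ring

/-- The joint Laplace–Fourier transform of a Gaussian pair. -/
lemma integral_exp_add_mul_I {X Y : Lp ℝ 2 P} (h : ∀ a b : ℝ, IsCentered (a • X + b • Y)) :
    ∫ ω, Complex.exp (X ω + Y ω * Complex.I) ∂P
      = Complex.exp (((‖X‖ ^ 2 - ‖Y‖ ^ 2) / 2 : ℝ) + (inner ℝ X Y : ℝ) * Complex.I) := by
  set c : ℝ := inner ℝ X Y / ‖X‖ ^ 2 with hc
  -- for `X = 0` this holds with the value `c = 0` of the division by zero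
  have hcX : c * ‖X‖ ^ 2 = inner ℝ X Y := by
    by_cases hX : X = 0
    · simp [hX]
    · have := norm_ne_zero_iff.2 hX
      rw [hc]
      field_simp
  -- `Y'` is the component of `Y` orthogonal to `X`
  set Y' : Lp ℝ 2 P := (-c) • X + (1 : ℝ) • Y with hY'
  have hcent : ∀ a b : ℝ, IsCentered (a • X + b • Y') := by
    intro a b
    convert h (a - b * c) b using 1
    rw [hY']
    module
  have hin : inner ℝ X Y' = 0 := by
    rw [hY', inner_add_right, real_inner_smul_right, real_inner_smul_right,
      real_inner_self_eq_norm_sq]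
    linarith
  have hind := indepFun_of_inner_eq_zero hcent hin
  have hX : IsCentered X := by simpa using hcent 1 0
  have hYc : IsCentered Y' := by simpa using hcent 0 1
  have hmX := aemeasurable_coe X
  have hmY := aemeasurable_coe Y'
  have h1 : ∀ᵐ ω ∂P, Complex.exp (X ω + Y ω * Complex.I)
      = Complex.exp ((1 + c * Complex.I) * X ω) * Complex.exp (Y' ω * Complex.I) := by
    filter_upwards [coe_smul_add_smul (-c) 1 X Y] with ω hω
    rw [hY', hω, ← Complex.exp_add]
    congr 1
    push_cast
    ring
  rw [integral_congr_ae h1]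
  have h2 : IndepFun (fun ω => Complex.exp ((1 + c * Complex.I) * X ω))
      (fun ω => Complex.exp (Y' ω * Complex.I)) P :=
    hind.comp (φ := fun x : ℝ => Complex.exp ((1 + c * Complex.I) * x))
      (ψ := fun x : ℝ => Complex.exp (x * Complex.I)) (by fun_prop) (by fun_prop)
  rw [h2.integral_fun_mul_eq_mul_integral
    (AEMeasurable.aestronglyMeasurable (by fun_prop))
    (AEMeasurable.aestronglyMeasurable (by fun_prop))]
  have h3 := complexMGF_gaussianReal hX (1 + c * Complex.I)
  rw [complexMGF] at h3
  have h4 := (isCentered_iff _).1 hYc 1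
  simp only [Complex.ofReal_one, one_mul] at h4
  rw [h3, h4, ← Complex.exp_add]
  congr 1
  have h5 : ‖Y'‖ ^ 2 = ‖Y‖ ^ 2 - c ^ 2 * ‖X‖ ^ 2 := by
    rw [hY', norm_add_sq_real, real_inner_smul_left, real_inner_smul_right, ← hcX, norm_smul,
      norm_smul, mul_pow, mul_pow, Real.norm_eq_abs, Real.norm_eq_abs, sq_abs, sq_abs]
    ring
  rw [h5, ← hcX]
  push_cast
  rw [show ((1 : ℂ) + c * Complex.I) ^ 2 = 1 + 2 * c * Complex.I - c ^ 2 by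
    rw [add_sq, mul_pow, Complex.I_sq]; ring]
  simp
  ring

/-- The Cameron–Martin theorem for a linear family `Z p` of centered Gaussian variables: a shift
`ℓ` that is bounded with respect to the `L²` norm of the family is represented by an element `X` of
its closed linear span, and tilting `P` by `X` shifts every `Z p` by `ℓ p`. -/
theorem exists_tilted_eq_shift {E : Type*} [AddCommMonoid E] [Module ℝ E]
    (Z : E →ₗ[ℝ] Ω → ℝ) (h2 : ∀ p, MemLp (Z p) 2 P) (hZ : ∀ p, IsCentered ((h2 p).toLp (Z p)))
    (ℓ : E →ₗ[ℝ] ℝ) (C : ℝ) (hℓ : ∀ p, |ℓ p| ≤ C * ‖(h2 p).toLp (Z p)‖) :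
    ∃ f : Ω → ℝ, Integrable (fun ω => Real.exp (f ω)) P ∧
      ∀ p, ∫ ω, Complex.exp (Z p ω * Complex.I) ∂(P.tilted f)
        = Complex.exp (ℓ p * Complex.I) * ∫ ω, Complex.exp (Z p ω * Complex.I) ∂P := by
  let _ : AddCommGroup E := Module.addCommMonoidToAddCommGroup ℝ
  set T := toLpLinear Z h2
  have hT : ∀ p, IsCentered (T p) := hZ
  replace hℓ : ∀ p, |ℓ p| ≤ C * ‖T p‖ := hℓ
  set K := (LinearMap.range T).topologicalClosure with hK
  have hTK : ∀ p, T p ∈ K := fun p => Submodule.le_topologicalClosure _ ⟨p, rfl⟩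
  have hKc : ∀ X ∈ K, IsCentered X := by
    intro X hX
    have : closure (LinearMap.range T : Set (Lp ℝ 2 P)) ⊆ {X | IsCentered X} :=
      closure_minimal (by rintro _ ⟨p, rfl⟩; exact hT p) isClosed_isCentered
    exact this hX
  -- `ℓ` factors through `T` and extends to a bounded functional on `L²`
  obtain ⟨g, hg⟩ : ∃ g : StrongDual ℝ (Lp ℝ 2 P), ∀ p, g (T p) = ℓ p := by
    have hker : LinearMap.ker T ≤ LinearMap.ker ℓ := by
      intro p hp
      rw [LinearMap.mem_ker] at hp ⊢
      have := hℓ p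
      rw [hp, norm_zero, mul_zero] at this
      exact abs_eq_zero.1 (le_antisymm this (abs_nonneg _))
    let g₀ : LinearMap.range T →ₗ[ℝ] ℝ :=
      (LinearMap.ker T).liftQ ℓ hker ∘ₗ T.quotKerEquivRange.symm.toLinearMap
    have hg₀ : ∀ p, g₀ ⟨T p, p, rfl⟩ = ℓ p := by
      intro p
      have : T.quotKerEquivRange.symm ⟨T p, p, rfl⟩ = (LinearMap.ker T).mkQ p := by
        rw [LinearEquiv.symm_apply_eq]
        rfl
      simp only [g₀, LinearMap.comp_apply, LinearEquiv.coe_coe, this]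
      simp
    let g₁ : StrongDual ℝ (LinearMap.range T) := g₀.mkContinuous C (by
      rintro ⟨_, p, rfl⟩
      rw [hg₀]
      exact hℓ p)
    obtain ⟨g, hg, -⟩ := exists_extension_norm_eq _ g₁
    exact ⟨g, fun p => (hg ⟨T p, p, rfl⟩).trans (hg₀ p)⟩
  have : CompleteSpace K := (Submodule.isClosed_topologicalClosure _).completeSpace_coe
  -- projecting the Riesz representative to `K` makes it Gaussian
  set X : Lp ℝ 2 P := K.starProjection ((InnerProductSpace.toDual ℝ _).symm g) with hX
  have hXK : X ∈ K := Submodule.starProjection_apply_mem _ _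
  have hin : ∀ p, inner ℝ X (T p) = ℓ p := by
    intro p
    rw [hX, Submodule.inner_starProjection_left_eq_right,
      Submodule.starProjection_eq_self_iff.2 (hTK p), InnerProductSpace.toDual_symm_apply, hg]
  have key : ∀ p, ∫ ω, Complex.exp (X ω + T p ω * Complex.I) ∂P
      = Complex.exp (((‖X‖ ^ 2 - ‖T p‖ ^ 2) / 2 : ℝ) + (ℓ p : ℝ) * Complex.I) := by
    intro p
    rw [integral_exp_add_mul_I, hin]
    exact fun a b => hKc _ (K.add_mem (K.smul_mem _ hXK) (K.smul_mem _ (hTK p)))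
  have hint : Integrable (fun ω => Real.exp (X ω)) P := by
    have h := integrable_exp_mul_gaussianReal (μ := 0) (v := ‖X‖₊ ^ 2) 1
    rw [← hKc X hXK, integrable_map_measure (by fun_prop) (aemeasurable_coe X)] at h
    simpa [Function.comp_def] using h
  have hmass : ∫ ω, Real.exp (X ω) ∂P = Real.exp (‖X‖ ^ 2 / 2) := by
    have h := mgf_gaussianReal (hKc X hXK) 1
    simpa [mgf] using h
  refine ⟨X, hint, fun p => ?_⟩
  have hTZ : ∀ μ : Measure Ω, μ ≪ P → ∫ ω, Complex.exp (Z p ω * Complex.I) ∂μ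
      = ∫ ω, Complex.exp (T p ω * Complex.I) ∂μ := fun μ hμ =>
    integral_congr_ae ((hμ.ae_eq (h2 p).coeFn_toLp).mono fun ω hω => by
      change T p ω = Z p ω at hω
      simp only [hω])
  rw [hTZ _ (tilted_absolutelyContinuous P X), hTZ P .rfl]
  rw [integral_tilted]
  have h1 : ∀ ω, (Real.exp (X ω) / ∫ ω, Real.exp (X ω) ∂P) • Complex.exp (T p ω * Complex.I)
      = Complex.exp (-(‖X‖ ^ 2 / 2 : ℝ)) * Complex.exp (X ω + T p ω * Complex.I) := by
    intro ω
    rw [hmass, Complex.exp_add, Complex.exp_neg, Complex.real_smul]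
    push_cast
    ring
  simp_rw [h1]
  have h3 := (isCentered_iff _).1 (hT p) 1
  simp only [Complex.ofReal_one, one_mul] at h3
  rw [integral_const_mul, key, h3, ← Complex.exp_add, ← Complex.exp_add]
  congr 1
  push_cast
  ring

end GaussianSpace

/-! ### Itô sums of a cylindrical Brownian motion -/

lemma measurable_itoSum {Ω H : Type*} (W : ℝ≥0 → H → Ω → ℝ) (f : ℝ≥0 → H) (t : ℝ≥0) (n : ℕ) :
    Measurable[sigmaNoise W] (itoSum W f t n) := by
  have h : ∀ s φ, Measurable[sigmaNoise W] (W s φ) := fun s φ =>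
    (comap_measurable (W s φ)).mono (le_iSup₂_of_le s φ le_rfl) le_rfl
  unfold itoSum
  exact Finset.measurable_sum _ fun i _ => (h _ _).sub (h _ _)

section Noise

variable {Ω : Type*} [MeasurableSpace Ω] {P : Measure Ω}
  {H : Type*} [NormedAddCommGroup H] [InnerProductSpace ℝ H] {W : ℝ≥0 → H → Ω → ℝ}

namespace IsCylindricalBrownianMotion

lemma memLp_two (hW : IsCylindricalBrownianMotion W P) (s : ℝ≥0) (φ : H) : MemLp (W s φ) 2 P :=
  (hW.gaussian.hasGaussianLaw_eval (s, φ)).memLp_two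

lemma hasGaussianLaw_itoSum (hW : IsCylindricalBrownianMotion W P) (f : ℝ≥0 → H) (t : ℝ≥0)
    (n : ℕ) : HasGaussianLaw (itoSum W f t n) P := by
  let idx : ℕ ⊕ ℕ → ℝ≥0 × H := Sum.elim
    (fun i => (((i : ℝ≥0) + 1) * t / n, f ((i : ℝ≥0) * t / n)))
    (fun i => ((i : ℝ≥0) * t / n, f ((i : ℝ≥0) * t / n)))
  have h := ((hW.gaussian.comp_right idx).smul
    (Sum.elim (fun _ => 1) (fun _ => -1))).hasGaussianLaw_fun_sum
    (I := (Finset.range n).disjSum (Finset.range n))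
  refine h.congr (.of_forall fun ω => ?_)
  simp only [itoSum, Finset.sum_disjSum]
  rw [← Finset.sum_add_distrib]
  refine Finset.sum_congr rfl fun i _ => ?_
  simp [idx, sub_eq_add_neg]

lemma integral_itoSum (hW : IsCylindricalBrownianMotion W P) (f : ℝ≥0 → H) (t : ℝ≥0)
    (n : ℕ) : ∫ ω, itoSum W f t n ω ∂P = 0 := by
  have hP : IsProbabilityMeasure P := hW.gaussian.isProbabilityMeasure
  have hi : ∀ s φ, Integrable (W s φ) P := fun s φ => (hW.memLp_two s φ).integrable one_le_two
  simp only [itoSum]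
  have hs : ∀ s u φ ψ, Integrable (fun ω => W s φ ω - W u ψ ω) P := fun s u φ ψ =>
    (hi s φ).sub (hi u ψ)
  rw [integral_finsetSum _ fun i _ => hs _ _ _ _]
  refine Finset.sum_eq_zero fun i _ => ?_
  rw [integral_sub (hi _ _) (hi _ _), hW.mean_zero, hW.mean_zero, sub_zero]

lemma integral_increment_mul (hW : IsCylindricalBrownianMotion W P) (a b c d : ℝ≥0) (φ ψ : H) :
    ∫ ω, (W b φ ω - W a φ ω) * (W d ψ ω - W c ψ ω) ∂P
      = ((min b d : ℝ≥0) - (min b c : ℝ≥0) - (min a d : ℝ≥0) + (min a c : ℝ≥0) : ℝ)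
        * inner ℝ φ ψ := by
  have hi : ∀ s u φ ψ, Integrable (fun ω => W s φ ω * W u ψ ω) P := fun s u φ ψ =>
    (hW.memLp_two s φ).integrable_mul (hW.memLp_two u ψ)
  have h : ∀ ω, (W b φ ω - W a φ ω) * (W d ψ ω - W c ψ ω)
      = W b φ ω * W d ψ ω - W b φ ω * W c ψ ω - W a φ ω * W d ψ ω + W a φ ω * W c ψ ω :=
    fun ω => by ring
  simp_rw [h]
  rw [integral_add (by fun_prop) (hi _ _ _ _), integral_sub (by fun_prop) (hi _ _ _ _),
    integral_sub (hi _ _ _ _) (hi _ _ _ _)]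
  simp only [hW.covariance]
  ring

/-- The Itô isometry for step functions. -/
lemma integral_itoSum_sq (hW : IsCylindricalBrownianMotion W P) (f : ℝ≥0 → H) (t : ℝ≥0)
    (n : ℕ) : ∫ ω, itoSum W f t n ω ^ 2 ∂P
      = ∑ i ∈ Finset.range n, (t / n : ℝ) * ‖f ((i : ℝ≥0) * t / n)‖ ^ 2 := by
  set D : ℕ → Ω → ℝ := fun i ω => W (((i : ℝ≥0) + 1) * t / n) (f ((i : ℝ≥0) * t / n)) ω
      - W ((i : ℝ≥0) * t / n) (f ((i : ℝ≥0) * t / n)) ω with hD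
  have hD2 : ∀ i, MemLp (D i) 2 P := fun i => (hW.memLp_two _ _).sub (hW.memLp_two _ _)
  have hDi : ∀ i j, Integrable (fun ω => D i ω * D j ω) P := fun i j =>
    (hD2 i).integrable_mul (hD2 j)
  have h : ∀ ω, itoSum W f t n ω ^ 2
      = ∑ i ∈ Finset.range n, ∑ j ∈ Finset.range n, D i ω * D j ω := by
    intro ω
    rw [sq, itoSum, Finset.sum_mul_sum]
  have hlt : ∀ i j : ℕ, i < j → ((i : ℝ≥0) + 1) * t / n ≤ (j : ℝ≥0) * t / n := by
    intro i j hij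
    gcongr
    exact_mod_cast hij
  have hle : ∀ i : ℕ, (i : ℝ≥0) * t / n ≤ ((i : ℝ≥0) + 1) * t / n := by
    intro i
    gcongr
    simp
  simp_rw [h]
  rw [integral_finsetSum _ fun i _ => integrable_finsetSum _ fun j _ => hDi i j]
  refine Finset.sum_congr rfl fun i hi => ?_
  rw [integral_finsetSum _ fun j _ => hDi i j, Finset.sum_eq_single i]
  · rw [hD]
    simp only []
    rw [hW.integral_increment_mul, min_self, min_self, min_eq_right (hle i), min_eq_left (hle i),
      real_inner_self_eq_norm_sq]
    push_cast
    ring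
  · intro j _ hj
    rw [hD]
    simp only []
    rw [hW.integral_increment_mul]
    rcases lt_or_gt_of_ne hj with hji | hij
    · have h1 := hlt j i hji
      have h2 := h1.trans (hle i)
      rw [min_eq_right h2, min_eq_right ((hle j).trans h2), min_eq_right h1,
        min_eq_right ((hle j).trans h1)]
      ring
    · have h1 := hlt i j hij
      have h2 := h1.trans (hle j)
      rw [min_eq_left h2, min_eq_left h1, min_eq_left ((hle i).trans h2),
        min_eq_left ((hle i).trans h1)]
      ring
  · exact fun h => absurd hi h

lemma isCentered_itoSum (hW : IsCylindricalBrownianMotion W P) (f : ℝ≥0 → H) (t : ℝ≥0)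
    (n : ℕ) : IsCentered ((hW.hasGaussianLaw_itoSum f t n).memLp_two.toLp _) :=
  isCentered_toLp (hW.hasGaussianLaw_itoSum f t n) (hW.integral_itoSum f t n)

lemma norm_sq_itoSum (hW : IsCylindricalBrownianMotion W P) (f : ℝ≥0 → H) (t : ℝ≥0)
    (n : ℕ) : ‖(hW.hasGaussianLaw_itoSum f t n).memLp_two.toLp _‖ ^ 2
      = ∑ i ∈ Finset.range n, (t / n : ℝ) * ‖f ((i : ℝ≥0) * t / n)‖ ^ 2 := by
  have h2 := (hW.hasGaussianLaw_itoSum f t n).memLp_two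
  rw [← integral_sq_eq_norm_sq, ← hW.integral_itoSum_sq]
  refine integral_congr_ae (h2.coeFn_toLp.mono fun ω h => ?_)
  simp only [h]

end IsCylindricalBrownianMotion

namespace IsStochasticIntegral

variable {f : ℝ≥0 → H} {t : ℝ≥0} {X : Ω → ℝ}

lemma memLp_two (hX : IsStochasticIntegral W P f t X) (hW : IsCylindricalBrownianMotion W P)
    (hm : Measurable X) : MemLp X 2 P := by
  obtain ⟨n, hn⟩ := (hX.eventually (gt_mem_nhds ENNReal.zero_lt_top)).exists
  have hY := (hW.hasGaussianLaw_itoSum f t n).memLp_two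
  have h : MemLp (fun ω => X ω - itoSum W f t n ω) 2 P :=
    ⟨hm.aestronglyMeasurable.sub hY.aestronglyMeasurable, hn⟩
  convert h.add hY using 1
  ext ω
  simp

lemma tendsto_toLp (hX : IsStochasticIntegral W P f t X) (hW : IsCylindricalBrownianMotion W P)
    (h2 : MemLp X 2 P) :
    Tendsto (fun n => (hW.hasGaussianLaw_itoSum f t n).memLp_two.toLp _) atTop
      (𝓝 (h2.toLp X)) := by
  refine (Lp.tendsto_Lp_iff_tendsto_eLpNorm'' _
    (fun n => (hW.hasGaussianLaw_itoSum f t n).memLp_two) X h2).2 ?_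
  refine hX.congr fun n => ?_
  exact eLpNorm_sub_comm X (itoSum W f t n) 2 P

lemma isCentered (hX : IsStochasticIntegral W P f t X) (hW : IsCylindricalBrownianMotion W P)
    (h2 : MemLp X 2 P) : IsCentered (h2.toLp X) := by
  have hP : IsProbabilityMeasure P := hW.gaussian.isProbabilityMeasure
  exact isClosed_isCentered.mem_of_tendsto (hX.tendsto_toLp hW h2)
    (.of_forall fun n => hW.isCentered_itoSum f t n)

lemma tendsto_norm_sq (hX : IsStochasticIntegral W P f t X) (hW : IsCylindricalBrownianMotion W P)
    (h2 : MemLp X 2 P) :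
    Tendsto (fun n : ℕ => ∑ i ∈ Finset.range n, (t / n : ℝ) * ‖f ((i : ℝ≥0) * t / n)‖ ^ 2) atTop
      (𝓝 (‖h2.toLp X‖ ^ 2)) :=
  ((hX.tendsto_toLp hW h2).norm.pow 2).congr fun n => hW.norm_sq_itoSum f t n

/-- A stochastic integral has a version that is measurable with respect to the noise. -/
lemma exists_ae_eq_measurable (hX : IsStochasticIntegral W P f t X)
    (hW : IsCylindricalBrownianMotion W P) (hm : Measurable X) :
    ∃ Y : Ω → ℝ, Measurable[sigmaNoise W] Y ∧ X =ᵐ[P] Y := by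
  have hmeas : TendstoInMeasure P (itoSum W f t) atTop X := by
    refine tendstoInMeasure_of_tendsto_eLpNorm two_ne_zero
      (fun n => (hW.hasGaussianLaw_itoSum f t n).memLp_two.aestronglyMeasurable)
      hm.aestronglyMeasurable (hX.congr fun n => ?_)
    exact eLpNorm_sub_comm X (itoSum W f t n) 2 P
  obtain ⟨ns, -, hae⟩ := hmeas.exists_seq_tendsto_ae
  have hlim : Measurable[sigmaNoise W] fun ω => limsup (fun i => itoSum W f t (ns i) ω) atTop :=
    Measurable.limsup fun i => measurable_itoSum W f t (ns i)
  refine ⟨_, hlim, ?_⟩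
  filter_upwards [hae] with ω hω
  exact hω.limsup_eq.symm

end IsStochasticIntegral

end Noise

/-! ### Testing distributions against real trigonometric polynomials -/

/-- The real vector space of real-valued trigonometric polynomials. -/
def realPoly : Submodule ℝ TrigPoly where
  carrier := {p | p.IsReal}
  add_mem' {p q} hp hq k := by
    rw [Finsupp.add_apply, Finsupp.add_apply, hp k, hq k, map_add]
  zero_mem' k := by simp
  smul_mem' a p hp k := by
    rw [Finsupp.smul_apply, Finsupp.smul_apply, hp k, Complex.real_smul, Complex.real_smul,
      map_mul, Complex.conj_ofReal]

namespace Distr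

lemma measurable_coeff : Measurable Distr.coeff := comap_measurable _

lemma measurable_coeff_apply (k : Mode) : Measurable fun u : Distr => u.coeff k :=
  (measurable_pi_apply k).comp measurable_coeff

lemma measurable_of_coeff {α : Type*} [MeasurableSpace α] {f : α → Distr}
    (hf : ∀ k, Measurable fun a => (f a).coeff k) : Measurable f :=
  measurable_comap_iff.2 (measurable_pi_lambda _ hf)

lemma coeff_add (u v : Distr) (k : Mode) : (u + v).coeff k = u.coeff k + v.coeff k := rfl

lemma measurable_add : Measurable fun q : Distr × Distr => q.1 + q.2 :=
  measurable_of_coeff fun k =>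
    ((measurable_coeff_apply k).comp measurable_fst).add
      ((measurable_coeff_apply k).comp measurable_snd)

lemma pair_eq_sum (u : Distr) (p : TrigPoly) :
    u.pair p = 2 * Real.pi * ∑ k ∈ p.support, (u.coeff k * conj (p k)).re := by
  rw [pair, Finsupp.sum, ← Complex.re_sum, ← Complex.re_ofReal_mul]
  push_cast
  rfl

lemma measurable_pair (p : TrigPoly) : Measurable fun u : Distr => u.pair p := by
  simp_rw [pair_eq_sum]
  refine Measurable.const_mul (Finset.measurable_sum _ fun k _ => ?_) _
  exact Complex.measurable_re.comp ((measurable_coeff_apply k).mul_const _)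

lemma pair_add_left (u v : Distr) (p : TrigPoly) : (u + v).pair p = u.pair p + v.pair p := by
  simp only [pair_eq_sum, coeff_add, add_mul, Complex.add_re, Finset.sum_add_distrib, mul_add]

/-- The pairing with a fixed distribution, as a real linear functional. -/
noncomputable def pairing (u : Distr) : TrigPoly →ₗ[ℝ] ℝ where
  toFun := u.pair
  map_add' p q := by
    simp only [pair]
    rw [Finsupp.sum_add_index' (by simp) (by intros; rw [map_add]; ring), mul_add, Complex.add_re]
  map_smul' a p := by
    simp only [pair]
    rw [Finsupp.sum_smul_index' (by simp)]
    simp only [Finsupp.sum, Complex.real_smul, map_mul, Complex.conj_ofReal, RingHom.id_apply,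
      smul_eq_mul]
    rw [← Complex.re_ofReal_mul]
    congr 1
    simp only [Finset.mul_sum]
    exact Finset.sum_congr rfl fun k _ => by ring

lemma exists_pair_eq_re (k : Mode) (c : ℂ) :
    ∃ p ∈ realPoly, ∀ u : Distr, u.pair p = (u.coeff k * conj c).re := by
  classical
  set a : ℂ := c / (4 * Real.pi) with ha
  have hca : (4 * Real.pi : ℂ) ≠ 0 := by exact_mod_cast (by positivity : (4 * Real.pi : ℝ) ≠ 0)
  refine ⟨Finsupp.single k a + Finsupp.single (-k) (conj a), fun l => ?_, fun u => ?_⟩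
  · have h1 : -l = k ↔ l = -k :=
      ⟨fun h => by rw [← h, mode_neg_neg], fun h => by rw [h, mode_neg_neg]⟩
    have h2 : -l = -k ↔ l = k := negEquiv.injective.eq_iff
    simp only [Finsupp.add_apply, Finsupp.single_apply, eq_comm (b := -l), eq_comm (b := l), h1, h2,
      map_add]
    split_ifs <;> simp [add_comm]
  · have hs : ∀ l b, u.pair (Finsupp.single l b) = (2 * Real.pi * (u.coeff l * conj b)).re := by
      intro l b
      rw [pair, Finsupp.sum_single_index (by simp)]
    have := u.pairing.map_add (Finsupp.single k a) (Finsupp.single (-k) (conj a))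
    change u.pair _ = u.pair _ + u.pair _ at this
    rw [this, hs, hs, u.real]
    have h3 : (2 * Real.pi * (conj (u.coeff k) * conj (conj a)) : ℂ)
        = conj (2 * Real.pi * (u.coeff k * conj a)) := by
      simp [Complex.conj_ofNat]
    rw [h3, Complex.conj_re, ← Complex.add_re, ← two_mul]
    congr 1
    have h4 : conj c = conj a * (4 * Real.pi) := by
      rw [ha, map_div₀]
      simp only [map_mul, Complex.conj_ofReal, Complex.conj_ofNat]
      field_simp
    rw [h4]
    ring

/-- Every real linear functional of finitely many Fourier coefficients is the pairing with a real
trigonometric polynomial. -/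
lemma exists_pair_eq_dual (I : Finset Mode) (L : StrongDual ℝ (I → ℂ)) :
    ∃ p ∈ realPoly, ∀ u : Distr, u.pair p = L (I.restrict u.coeff) := by
  classical
  have hL : ∀ v : I → ℂ, L v = ∑ i, (v i * conj ((L (Pi.single i 1) : ℂ)
      + L (Pi.single i Complex.I) * Complex.I)).re := by
    intro v
    conv_lhs => rw [← Finset.univ_sum_single v, map_sum]
    refine Finset.sum_congr rfl fun i _ => ?_
    have : (Pi.single i (v i) : I → ℂ) = (v i).re • (Pi.single i 1 : I → ℂ)
        + (v i).im • (Pi.single i Complex.I : I → ℂ) := by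
      rw [← Pi.single_smul, ← Pi.single_smul, ← Pi.single_add]
      congr 1
      apply Complex.ext <;> simp
    rw [this, map_add, map_smul, map_smul]
    simp
  choose p hp hpu using fun i : I => exists_pair_eq_re i ((L (Pi.single i 1) : ℂ)
      + L (Pi.single i Complex.I) * Complex.I)
  refine ⟨∑ i, p i, realPoly.sum_mem fun i _ => hp i, fun u => ?_⟩
  rw [hL]
  change u.pairing _ = _
  rw [map_sum]
  exact Finset.sum_congr rfl fun i _ => hpu i u

/-- A probability measure on distributions is determined by its characteristic functional on real
trigonometric polynomials. -/
lemma measure_ext {μ ν : Measure Distr} [IsProbabilityMeasure μ] [IsProbabilityMeasure ν]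
    (h : ∀ p ∈ realPoly, ∫ u, Complex.exp (u.pair p * Complex.I) ∂μ
      = ∫ u, Complex.exp (u.pair p * Complex.I) ∂ν) : μ = ν := by
  have hc : μ.map Distr.coeff = ν.map Distr.coeff := by
    have := Measure.isProbabilityMeasure_map (μ := μ) measurable_coeff.aemeasurable
    have := Measure.isProbabilityMeasure_map (μ := ν) measurable_coeff.aemeasurable
    refine IsProjectiveLimit.unique (P := fun I => (μ.map Distr.coeff).map I.restrict)
      (fun I => rfl) (fun I => ?_)
    have hI := Finset.measurable_restrict (X := fun _ : Mode => ℂ) I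
    have := Measure.isProbabilityMeasure_map (μ := μ.map Distr.coeff) hI.aemeasurable
    have := Measure.isProbabilityMeasure_map (μ := ν.map Distr.coeff) hI.aemeasurable
    refine Measure.ext_of_charFunDual (funext fun L => ?_)
    obtain ⟨p, hp, hpL⟩ := exists_pair_eq_dual I L
    have key : ∀ ρ : Measure Distr, charFunDual ((ρ.map Distr.coeff).map I.restrict) L
        = ∫ u, Complex.exp (u.pair p * Complex.I) ∂ρ := by
      intro ρ
      rw [charFunDual_apply, Measure.map_map hI measurable_coeff,
        integral_map (hI.comp measurable_coeff).aemeasurable (by fun_prop)]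
      simp only [hpL, Function.comp_apply]
    rw [key, key, h p hp]
  ext s hs
  obtain ⟨B, hB, rfl⟩ := hs
  rw [← Measure.map_apply measurable_coeff hB, ← Measure.map_apply measurable_coeff hB, hc]

/-- The Cauchy–Schwarz inequality between dual weighted norms. -/
lemma abs_pair_le {w : Mode → ℝ} (hw : ∀ k, 0 < w k) {u : Distr}
    (hu : Summable fun k => (w k)⁻¹ * ‖u.coeff k‖ ^ 2) (p : TrigPoly) :
    |u.pair p| ≤ 2 * Real.pi * Real.sqrt (∑' k, (w k)⁻¹ * ‖u.coeff k‖ ^ 2)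
      * Real.sqrt (TrigPoly.wsq w p) := by
  rw [pair_eq_sum, abs_mul, abs_of_pos Real.two_pi_pos, mul_assoc (2 * Real.pi) (Real.sqrt _)]
  refine mul_le_mul_of_nonneg_left ?_ Real.two_pi_pos.le
  calc |∑ k ∈ p.support, (u.coeff k * conj (p k)).re|
      ≤ ∑ k ∈ p.support, ‖u.coeff k‖ * ‖p k‖ := by
        refine (Finset.abs_sum_le_sum_abs _ _).trans (Finset.sum_le_sum fun k _ => ?_)
        refine (Complex.abs_re_le_norm _).trans ?_
        rw [norm_mul, RCLike.norm_conj]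
    _ = ∑ k ∈ p.support, Real.sqrt ((w k)⁻¹ * ‖u.coeff k‖ ^ 2) * Real.sqrt (w k * ‖p k‖ ^ 2) := by
        refine Finset.sum_congr rfl fun k _ => ?_
        rw [← Real.sqrt_mul (by have := hw k; positivity), ← Real.sqrt_sq (by positivity :
          0 ≤ ‖u.coeff k‖ * ‖p k‖)]
        congr 1
        have := (hw k).ne'
        field_simp
    _ ≤ Real.sqrt (∑ k ∈ p.support, (w k)⁻¹ * ‖u.coeff k‖ ^ 2)
        * Real.sqrt (∑ k ∈ p.support, w k * ‖p k‖ ^ 2) :=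
        Real.sum_sqrt_mul_sqrt_le _ (fun k => by have := hw k; positivity)
          (fun k => by have := hw k; positivity)
    _ ≤ _ := by
        refine mul_le_mul_of_nonneg_right (Real.sqrt_le_sqrt ?_) (Real.sqrt_nonneg _)
        exact hu.sum_le_tsum _ fun k _ => by have := hw k; positivity

end Distr

/-! ### Nondegeneracy of the stochastic convolution -/

/-- A lower bound for the left Riemann sums of `∫_0^t e^{-2(t-s)a} ds`. -/
lemma eventually_le_riemann_sum {t : ℝ≥0} (ht : 0 < t) {a : ℝ} (ha : 1 ≤ a) :
    ∀ᶠ n : ℕ in atTop, (1 - Real.exp (-2 * t)) / (6 * a)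
      ≤ ∑ i ∈ Finset.range n, (t / n : ℝ)
        * Real.exp (-((t - (i : ℝ≥0) * t / n : ℝ≥0) : ℝ) * a) ^ 2 := by
  obtain ⟨N, hN⟩ := exists_nat_ge (2 * (t : ℝ) * a)
  filter_upwards [eventually_ge_atTop N, eventually_gt_atTop 0] with n hn hn0
  have hn0' : (0 : ℝ) < n := by exact_mod_cast hn0
  have ht' : (0 : ℝ) < t := by exact_mod_cast ht
  have hna : 2 * a * (t / n) ≤ 1 := by
    have : (N : ℝ) ≤ n := by exact_mod_cast hn
    rw [← mul_div_assoc, div_le_one hn0']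
    linarith
  set E : ℕ → ℝ := fun i => Real.exp (-2 * a * (t - i * t / n)) with hE
  have hterm : ∀ i ∈ Finset.range n,
      Real.exp (-((t - (i : ℝ≥0) * t / n : ℝ≥0) : ℝ) * a) ^ 2 = E i := by
    intro i hi
    have hle : (i : ℝ≥0) * t / n ≤ t := by
      have h1 : (i : ℝ≥0) ≤ n := by exact_mod_cast (Finset.mem_range.1 hi).le
      exact div_le_of_le_mul₀ (by positivity) (by positivity) (by rw [mul_comm]; gcongr)
    rw [← Real.exp_nat_mul, NNReal.coe_sub hle, hE]
    congr 1
    push_cast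
    ring
  -- the increments of the antiderivative are dominated by the terms of the sum
  have hinc : ∀ i, E (i + 1) - E i ≤ 6 * a * ((t / n : ℝ) * E i) := by
    intro i
    have h1 : E (i + 1) = E i * Real.exp (2 * a * (t / n)) := by
      rw [hE]
      simp only []
      rw [← Real.exp_add]
      congr 1
      push_cast
      field_simp
      ring
    have h2 : Real.exp (2 * a * (t / n)) - 1 ≤ 3 * (2 * a * (t / n)) := by
      have hx0 : 0 ≤ 2 * a * (t / n : ℝ) := by positivity
      have h3 := Real.add_one_le_exp (-(2 * a * (t / n : ℝ)))
      have h4 : Real.exp (2 * a * (t / n)) ≤ 3 :=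
        (Real.exp_le_exp.2 hna).trans (Real.exp_one_lt_d9.le.trans (by norm_num))
      have h5 : Real.exp (2 * a * (t / n)) * Real.exp (-(2 * a * (t / n))) = 1 := by
        rw [← Real.exp_add, add_neg_cancel, Real.exp_zero]
      have h6 := Real.exp_pos (2 * a * (t / n : ℝ))
      nlinarith
    have h7 : 0 < E i := Real.exp_pos _
    rw [h1]
    nlinarith
  have hsum := Finset.sum_le_sum fun i (_ : i ∈ Finset.range n) => hinc i
  rw [Finset.sum_range_sub, ← Finset.mul_sum] at hsum
  rw [Finset.sum_congr rfl fun i hi => by rw [hterm i hi], div_le_iff₀' (by positivity)]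
  refine le_trans ?_ hsum
  have hEn : E n = 1 := by
    rw [hE]
    simp only []
    rw [mul_div_assoc, mul_div_cancel₀ _ hn0'.ne', sub_self, mul_zero, Real.exp_zero]
  have hE0 : E 0 ≤ Real.exp (-2 * t) := by
    rw [hE]
    simp only [Nat.cast_zero, zero_mul, zero_div, sub_zero]
    refine Real.exp_le_exp.2 ?_
    nlinarith
  rw [hEn]
  linarith

section Law

variable {Ω : Type*} [MeasurableSpace Ω] {P : Measure Ω} {W : ℝ≥0 → L2Torus → Ω → ℝ}

/-- The covariance `∫_0^t e^{-sA} Ξ Ξ* e^{-sA} ds` of the stochastic convolution dominates a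
multiple of `A^{β-1}`. -/
lemma exists_wsq_le_norm_sq (hW : IsCylindricalBrownianMotion W P) {β : ℝ} {Ξ : NoiseOperator}
    (hΞ : Ξ.ApproxPower β) {t : ℝ≥0} (ht : 0 < t) :
    ∃ K : ℝ, 0 < K ∧ ∀ p : TrigPoly, p.IsReal → ∀ X : Ω → ℝ, ∀ h2 : MemLp X 2 P,
      IsStochasticIntegral W P (fun s => (Ξ.adj (TrigPoly.heat (t - s) p)).toL2) t X →
      TrigPoly.wsq (fun k => eig k ^ (β - 1)) p ≤ K * ‖h2.toLp X‖ ^ 2 := by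
  obtain ⟨C, hC, hcoer⟩ := hΞ.coercive
  set δ : ℝ := (1 - Real.exp (-2 * t)) / 6 with hδ
  have hδ0 : 0 < δ := by
    have ht' : (0 : ℝ) < t := by exact_mod_cast ht
    have : Real.exp (-2 * t) < 1 := by
      rw [← Real.exp_zero]
      exact Real.exp_lt_exp.2 (by linarith)
    rw [hδ]
    linarith
  refine ⟨C / (2 * Real.pi * δ), by positivity, fun p hp X h2 hX => ?_⟩
  have hev : ∀ᶠ n : ℕ in atTop, ∀ k ∈ p.support, δ / eig k ≤ ∑ i ∈ Finset.range n, (t / n : ℝ)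
        * Real.exp (-((t - (i : ℝ≥0) * t / n : ℝ≥0) : ℝ) * eig k) ^ 2 := by
    rw [eventually_all_finset]
    intro k _
    rw [hδ, div_div]
    exact eventually_le_riemann_sum ht (one_le_eig k)
  have hbound : ∀ᶠ n : ℕ in atTop, 2 * Real.pi * δ / C * TrigPoly.wsq (fun k => eig k ^ (β - 1)) p
      ≤ ∑ i ∈ Finset.range n, (t / n : ℝ)
        * ‖(Ξ.adj (TrigPoly.heat (t - (i : ℝ≥0) * t / n) p)).toL2‖ ^ 2 := by
    filter_upwards [hev] with n hn
    have h1 : ∀ r : ℝ≥0, 2 * Real.pi / C * ∑ k ∈ p.support, eig k ^ β *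
        (Real.exp (-(r : ℝ) * eig k) ^ 2 * ‖p k‖ ^ 2)
        ≤ ‖(Ξ.adj (TrigPoly.heat r p)).toL2‖ ^ 2 := by
      intro r
      have h2 := hcoer (TrigPoly.heat r p)
      rw [TrigPoly.heat, TrigPoly.wsq_eq_sum (TrigPoly.support_multiplier_subset _ p),
        ← TrigPoly.heat] at h2
      rw [TrigPoly.norm_toL2_sq (Ξ.isReal_adj (TrigPoly.isReal_heat hp r))]
      rw [div_mul_eq_mul_div, div_le_iff₀ hC, mul_assoc (2 * Real.pi) (TrigPoly.wsq _ _)]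
      refine mul_le_mul_of_nonneg_left ?_ Real.two_pi_pos.le
      rw [mul_comm _ C]
      refine le_of_eq_of_le (Finset.sum_congr rfl fun k _ => ?_) h2
      rw [TrigPoly.heat, TrigPoly.multiplier_apply, norm_mul, mul_pow, Complex.norm_real,
        Real.norm_of_nonneg (Real.exp_pos _).le]
    calc 2 * Real.pi * δ / C * TrigPoly.wsq (fun k => eig k ^ (β - 1)) p
        = 2 * Real.pi / C * ∑ k ∈ p.support, eig k ^ β * (δ / eig k * ‖p k‖ ^ 2) := by
          rw [TrigPoly.wsq, Finset.mul_sum, Finset.mul_sum]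
          refine Finset.sum_congr rfl fun k _ => ?_
          rw [Real.rpow_sub_one (eig_pos k).ne']
          ring
      _ ≤ 2 * Real.pi / C * ∑ k ∈ p.support, eig k ^ β * ((∑ i ∈ Finset.range n, (t / n : ℝ)
        * Real.exp (-((t - (i : ℝ≥0) * t / n : ℝ≥0) : ℝ) * eig k) ^ 2) * ‖p k‖ ^ 2) := by
          refine mul_le_mul_of_nonneg_left (Finset.sum_le_sum fun k hk => ?_) (by positivity)
          exact mul_le_mul_of_nonneg_left (mul_le_mul_of_nonneg_right (hn k hk) (sq_nonneg _))
            (Real.rpow_nonneg (eig_nonneg k) _)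
      _ = ∑ i ∈ Finset.range n, (t / n : ℝ) * (2 * Real.pi / C * ∑ k ∈ p.support, eig k ^ β *
          (Real.exp (-((t - (i : ℝ≥0) * t / n : ℝ≥0) : ℝ) * eig k) ^ 2 * ‖p k‖ ^ 2)) := by
          simp only [Finset.mul_sum, Finset.sum_mul]
          rw [Finset.sum_comm]
          refine Finset.sum_congr rfl fun i _ => Finset.sum_congr rfl fun k _ => by ring
      _ ≤ _ := Finset.sum_le_sum fun i _ => mul_le_mul_of_nonneg_left (h1 _) (by positivity)
  have h3 := ge_of_tendsto (hX.tendsto_norm_sq hW h2) hbound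
  rw [div_mul_eq_mul_div, le_div_iff₀ (by positivity)]
  rw [div_mul_eq_mul_div, div_le_iff₀ hC] at h3
  linarith

/-! ### Shifts of the stochastic convolution -/

/-- The law of the stochastic convolution at a positive time is quasi-invariant under shifts by
elements of the domain of `A^{(1-β)/2}`. -/
theorem map_add_equivalent [IsProbabilityMeasure P] (hW : IsCylindricalBrownianMotion W P)
    {β : ℝ} {Ξ : NoiseOperator} (hΞ : Ξ.ApproxPower β) {z₀ : Distr} {z : ℝ≥0 → Ω → Distr}
    (hz : IsStochasticConvolution P W Ξ z₀ z) {t : ℝ≥0} (ht : 0 < t) {h : Distr}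
    (hh : Summable fun k => eig k ^ (1 - β) * ‖h.coeff k‖ ^ 2) :
    P.map (fun ω => z t ω + h) ≪ P.map (z t) ∧ P.map (z t) ≪ P.map (fun ω => z t ω + h) := by
  obtain ⟨K, hK, hcov⟩ := exists_wsq_le_norm_sq hW hΞ ht
  set m : TrigPoly → ℝ := (z₀.heat t).pair with hm
  have hmeas : ∀ p, Measurable fun ω => (z t ω).pair p - m p := fun p =>
    ((Distr.measurable_pair p).comp (hz.measurable t)).sub_const _
  obtain ⟨Z, hZ⟩ : ∃ Z : realPoly →ₗ[ℝ] Ω → ℝ, ∀ p ω, Z p ω = (z t ω).pair p - m p :=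
    ⟨LinearMap.pi fun ω => ((z t ω).pairing - (z₀.heat t).pairing) ∘ₗ realPoly.subtype,
      fun p ω => rfl⟩
  obtain ⟨ℓ, hℓ⟩ : ∃ ℓ : realPoly →ₗ[ℝ] ℝ, ∀ p, ℓ p = h.pair p :=
    ⟨h.pairing ∘ₗ realPoly.subtype, fun p => rfl⟩
  have hint : ∀ p : realPoly, IsStochasticIntegral W P
      (fun s => (Ξ.adj (TrigPoly.heat (t - s) p)).toL2) t (Z p) := fun p => by
    rw [funext (hZ p)]
    exact hz.mild t p p.2
  have h2 : ∀ p : realPoly, MemLp (Z p) 2 P := fun p => by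
    refine (hint p).memLp_two hW ?_
    rw [funext (hZ p)]
    exact hmeas p
  have hZc : ∀ p, IsCentered ((h2 p).toLp (Z p)) := fun p => (hint p).isCentered hW (h2 p)
  have hh' : Summable fun k => (eig k ^ (β - 1))⁻¹ * ‖h.coeff k‖ ^ 2 := by
    refine hh.congr fun k => ?_
    rw [← Real.rpow_neg (eig_nonneg k), neg_sub]
  have hb : ∀ p : realPoly, |ℓ p| ≤ 2 * Real.pi
      * Real.sqrt (∑' k, (eig k ^ (β - 1))⁻¹ * ‖h.coeff k‖ ^ 2) * Real.sqrt K
        * ‖(h2 p).toLp (Z p)‖ := by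
    intro p
    rw [hℓ]
    refine (Distr.abs_pair_le (fun k => Real.rpow_pos_of_pos (eig_pos k) _) hh' p).trans ?_
    rw [mul_assoc _ (Real.sqrt K)]
    refine mul_le_mul_of_nonneg_left ?_ (by positivity)
    refine (Real.sqrt_le_sqrt (hcov p p.2 _ (h2 p) (hint p))).trans_eq ?_
    rw [Real.sqrt_mul hK.le, Real.sqrt_sq (norm_nonneg _)]
  obtain ⟨f, hf, hshift⟩ := exists_tilted_eq_shift Z h2 hZc ℓ _ hb
  have hQ : IsProbabilityMeasure (P.tilted f) := isProbabilityMeasure_tilted hf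
  have hza : Measurable fun ω => z t ω + h :=
    Distr.measurable_add.comp ((hz.measurable t).prodMk measurable_const)
  have := Measure.isProbabilityMeasure_map (μ := P.tilted f) (hz.measurable t).aemeasurable
  have := Measure.isProbabilityMeasure_map (μ := P) hza.aemeasurable
  have hlaw : (P.tilted f).map (z t) = P.map fun ω => z t ω + h := by
    refine Distr.measure_ext fun p hp => ?_
    have hpm : ∀ μ : Measure Distr,
        AEStronglyMeasurable (fun u : Distr => Complex.exp (u.pair p * Complex.I)) μ := fun μ => by
      have := Distr.measurable_pair p
      exact Measurable.aestronglyMeasurable (by fun_prop)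
    rw [integral_map (hz.measurable t).aemeasurable (hpm _), integral_map hza.aemeasurable (hpm _)]
    have e := hshift ⟨p, hp⟩
    have e1 : ∫ ω, Complex.exp ((z t ω).pair p * Complex.I) ∂P.tilted f
        = Complex.exp (m p * Complex.I)
          * ∫ ω, Complex.exp (Z ⟨p, hp⟩ ω * Complex.I) ∂P.tilted f := by
      rw [← integral_const_mul]
      refine integral_congr_ae (.of_forall fun ω => ?_)
      simp only [hZ]
      rw [← Complex.exp_add]
      congr 1
      push_cast
      ring
    have e2 : ∫ ω, Complex.exp ((z t ω + h).pair p * Complex.I) ∂P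
        = Complex.exp (m p * Complex.I) * (Complex.exp (h.pair p * Complex.I)
          * ∫ ω, Complex.exp (Z ⟨p, hp⟩ ω * Complex.I) ∂P) := by
      rw [← integral_const_mul, ← integral_const_mul]
      refine integral_congr_ae (.of_forall fun ω => ?_)
      simp only [hZ, Distr.pair_add_left]
      rw [← Complex.exp_add, ← Complex.exp_add]
      congr 1
      push_cast
      ring
    rw [e1, e2, e, hℓ]
  rw [← hlaw]
  exact ⟨(tilted_absolutelyContinuous P f).map (hz.measurable t),
    (absolutelyContinuous_tilted hf).map (hz.measurable t)⟩

end Law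

/-! ### Conditional laws given an independent σ-algebra -/

instance : MeasurableSpace.CountablyGenerated Distr := MeasurableSpace.CountablyGenerated.comap _

section CondLaw

variable {Ω E : Type*} {m : MeasurableSpace Ω} [mΩ : MeasurableSpace Ω] [MeasurableSpace E]
  {P : Measure Ω}

lemma IsCondLaw.ae_eq [MeasurableSpace.CountablyGenerated E] {X : Ω → E} {κ κ' : Ω → Measure E}
    (hκ : IsCondLaw m P X κ) (hκ' : IsCondLaw m P X κ') : κ =ᵐ[P] κ' := by
  set 𝒞 := generateSetAlgebra (MeasurableSpace.countableGeneratingSet E) with h𝒞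
  have hgen : MeasurableSpace.generateFrom 𝒞 = ‹MeasurableSpace E› := by
    rw [generateFrom_generateSetAlgebra_eq, MeasurableSpace.generateFrom_countableGeneratingSet]
  have hcount : 𝒞.Countable :=
    countable_generateSetAlgebra MeasurableSpace.countable_countableGeneratingSet
  have hpi : IsPiSystem 𝒞 := fun s hs t ht _ => isSetAlgebra_generateSetAlgebra.inter_mem hs ht
  have h : ∀ᵐ ω ∂P, ∀ B ∈ 𝒞, (κ ω B).toReal = (κ' ω B).toReal := by
    refine (ae_ball_iff hcount).2 fun B hB => ?_
    have hBm : MeasurableSet B := by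
      rw [← hgen]
      exact MeasurableSpace.measurableSet_generateFrom hB
    exact (hκ.condExp B hBm).trans (hκ'.condExp B hBm).symm
  filter_upwards [h] with ω hω
  have := hκ.prob ω
  have := hκ'.prob ω
  refine ext_of_generate_finite 𝒞 hgen.symm hpi (fun B hB => ?_) (by simp)
  exact (ENNReal.toReal_eq_toReal_iff' (measure_ne_top _ _) (measure_ne_top _ _)).1 (hω B hB)

/-- The freezing lemma: if `Z` is independent of `m` and `H` is `m`-measurable, the conditional law
of `Φ (Z, H)` is obtained by freezing the value of `H`. -/
lemma isCondLaw_of_indepFun [IsProbabilityMeasure P] (hm : m ≤ mΩ) {Z H : Ω → E}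
    {Φ : E × E → E} (hΦ : Measurable Φ) (hZ : Measurable Z) (hH : Measurable[m] H)
    (hind : Indep (MeasurableSpace.comap Z inferInstance) m P) :
    IsCondLaw m P (fun ω => Φ (Z ω, H ω)) (fun ω => P.map fun ω' => Φ (Z ω', H ω)) := by
  have hHΩ : Measurable H := hH.mono hm le_rfl
  have hfreeze : ∀ ω, Measurable fun ω' => Φ (Z ω', H ω) := fun ω =>
    hΦ.comp (hZ.prodMk measurable_const)
  have hPZ := Measure.isProbabilityMeasure_map (μ := P) hZ.aemeasurable
  have happly : ∀ ω B, MeasurableSet B →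
      P.map (fun ω' => Φ (Z ω', H ω)) B = P.map Z ((fun x => (x, H ω)) ⁻¹' (Φ ⁻¹' B)) := by
    intro ω B hB
    rw [Measure.map_apply (hfreeze ω) hB, Measure.map_apply hZ (measurable_prodMk_right (hΦ hB))]
    rfl
  have hmeas : ∀ B, MeasurableSet B →
      Measurable[m] fun ω => P.map (fun ω' => Φ (Z ω', H ω)) B := by
    intro B hB
    simp_rw [fun ω => happly ω B hB]
    exact (measurable_measure_prodMk_right (hΦ hB)).comp hH
  refine ⟨fun ω => Measure.isProbabilityMeasure_map (hfreeze ω).aemeasurable, hmeas,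
    fun B hB => ?_⟩
  have hprob : ∀ ω, IsProbabilityMeasure (P.map fun ω' => Φ (Z ω', H ω)) := fun ω =>
    Measure.isProbabilityMeasure_map (hfreeze ω).aemeasurable
  have hX : MeasurableSet ((fun ω => Φ (Z ω, H ω)) ⁻¹' B) := (hΦ.comp (hZ.prodMk hHΩ)) hB
  have hint : Integrable (fun ω => (P.map (fun ω' => Φ (Z ω', H ω)) B).toReal) P := by
    refine Integrable.of_bound
      ((hmeas B hB).mono hm le_rfl).ennreal_toReal.aestronglyMeasurable 1 (.of_forall fun ω => ?_)
    rw [Real.norm_of_nonneg ENNReal.toReal_nonneg]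
    exact measureReal_le_one
  refine ae_eq_condExp_of_forall_setIntegral_eq hm ((integrable_const _).indicator hX)
    (fun s _ _ => hint.integrableOn) (fun s hs _ => ?_)
    (hmeas B hB).ennreal_toReal.stronglyMeasurable.aestronglyMeasurable
  -- the event `s` is recorded as a second, `Prop`-valued component next to `H`
  set Y : Ω → E × Prop := fun ω => (H ω, ω ∈ s) with hY
  have hYm : Measurable[m] Y := hH.prodMk ((@measurable_mem _ s m).2 hs)
  have hYΩ : Measurable Y := hYm.mono hm le_rfl
  have hindY : IndepFun Z Y P := indep_of_indep_of_le_right hind hYm.comap_le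
  have hprod := (indepFun_iff_map_prod_eq_prod_map_map hZ.aemeasurable hYΩ.aemeasurable).1 hindY
  set S : Set (E × (E × Prop)) := {q | q.2.2 ∧ Φ (q.1, q.2.1) ∈ B} with hS
  have hSm : MeasurableSet S := by
    have h1 : Measurable fun q : E × (E × Prop) => q.2.2 := measurable_snd.comp measurable_snd
    have h2 : Measurable fun q : E × (E × Prop) => Φ (q.1, q.2.1) :=
      hΦ.comp (measurable_fst.prodMk (measurable_fst.comp measurable_snd))
    exact (measurableSet_setOfPred.2 h1).inter (h2 hB)
  have hsΩ := hm s hs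
  have key : P ((fun ω => Φ (Z ω, H ω)) ⁻¹' B ∩ s)
      = ∫⁻ ω in s, P.map (fun ω' => Φ (Z ω', H ω)) B ∂P := by
    have e1 : P ((fun ω => Φ (Z ω, H ω)) ⁻¹' B ∩ s) = P.map (fun ω => (Z ω, Y ω)) S := by
      rw [Measure.map_apply (hZ.prodMk hYΩ) hSm, Set.inter_comm]
      rfl
    rw [e1, hprod, Measure.prod_apply_symm hSm,
      lintegral_map (measurable_measure_prodMk_right hSm) hYΩ, ← lintegral_indicator hsΩ]
    refine lintegral_congr fun ω => ?_
    by_cases hω : ω ∈ s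
    · rw [Set.indicator_of_mem hω, happly ω B hB]
      congr 1
      ext x
      simp [hS, hY, hω]
    · rw [Set.indicator_of_notMem hω]
      have : (fun x => (x, Y ω)) ⁻¹' S = ∅ := by
        ext x
        simp [hS, hY, hω]
      rw [this, measure_empty]
  rw [integral_indicator hX, Measure.restrict_restrict hX, setIntegral_const, smul_eq_mul, mul_one,
    measureReal_def, key, integral_toReal ((hmeas B hB).mono hm le_rfl).aemeasurable
      (.of_forall fun ω => measure_lt_top _ _)]

lemma condLawEquivalent_of_indepFun [IsProbabilityMeasure P]
    [MeasurableSpace.CountablyGenerated E] (hm : m ≤ mΩ) {Z H : Ω → E}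
    {Φ : E × E → E} (hΦ : Measurable Φ) (hZ : Measurable Z) (hH : Measurable[m] H)
    (hind : Indep (MeasurableSpace.comap Z inferInstance) m P) {ν : Measure E}
    (hν : ∀ᵐ ω ∂P, P.map (fun ω' => Φ (Z ω', H ω)) ≪ ν ∧ ν ≪ P.map (fun ω' => Φ (Z ω', H ω))) :
    CondLawEquivalent m P (fun ω => Φ (Z ω, H ω)) ν := by
  have h := isCondLaw_of_indepFun hm hΦ hZ hH hind
  refine ⟨⟨_, h⟩, fun κ hκ => ?_⟩
  filter_upwards [hκ.ae_eq h, hν] with ω h1 h2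
  rwa [h1]

end CondLaw

/-- The stochastic convolution is independent of every σ-algebra that is independent of the
noise. -/
lemma IsStochasticConvolution.indep {Ω : Type*} {m : MeasurableSpace Ω} [MeasurableSpace Ω]
    {P : Measure Ω} {W : ℝ≥0 → L2Torus → Ω → ℝ} (hW : IsCylindricalBrownianMotion W P)
    {Ξ : NoiseOperator} {z₀ : Distr} {z : ℝ≥0 → Ω → Distr}
    (hz : IsStochasticConvolution P W Ξ z₀ z) (hm : Indep m (sigmaNoise W) P) (t : ℝ≥0) :
    Indep (MeasurableSpace.comap (z t) inferInstance) m P := by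
  have hpair : ∀ p ∈ realPoly, ∃ Y : Ω → ℝ, Measurable[sigmaNoise W] Y ∧
      (fun ω => (z t ω).pair p) =ᵐ[P] Y := by
    intro p hp
    obtain ⟨Y, hY, hYe⟩ := (hz.mild t p hp).exists_ae_eq_measurable hW
      (((Distr.measurable_pair p).comp (hz.measurable t)).sub_const _)
    refine ⟨fun ω => Y ω + (z₀.heat t).pair p, hY.add_const _, hYe.mono fun ω hω => ?_⟩
    simp only [← hω]
    ring
  have hcoeff : ∀ k, ∃ Y : Ω → ℂ, Measurable[sigmaNoise W] Y ∧
      (fun ω => (z t ω).coeff k) =ᵐ[P] Y := by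
    intro k
    obtain ⟨p, hp, hpe⟩ := Distr.exists_pair_eq_re k 1
    obtain ⟨q, hq, hqe⟩ := Distr.exists_pair_eq_re k Complex.I
    obtain ⟨Y, hY, hYe⟩ := hpair p hp
    obtain ⟨Y', hY', hYe'⟩ := hpair q hq
    refine ⟨fun ω => Y ω + Y' ω * Complex.I, ?_, ?_⟩
    · exact (Complex.measurable_ofReal.comp hY).add
        ((Complex.measurable_ofReal.comp hY').mul_const _)
    · filter_upwards [hYe, hYe'] with ω h1 h2
      rw [← h1, ← h2, hpe, hqe]
      apply Complex.ext <;> simp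
  choose Y hY hYe using hcoeff
  have h1 : @IndepFun Ω (Mode → ℂ) Ω _ _ m (fun ω k => Y k ω) id P := by
    have hYm : Measurable[sigmaNoise W] fun ω k => Y k ω :=
      @measurable_pi_lambda _ _ _ (sigmaNoise W) _ _ hY
    refine indep_of_indep_of_le_left ?_ hYm.comap_le
    rw [MeasurableSpace.comap_id]
    exact hm.symm
  have h2 : (fun ω k => Y k ω) =ᵐ[P] fun ω => (z t ω).coeff := by
    filter_upwards [ae_all_iff.2 hYe] with ω hω
    exact funext fun k => (hω k).symm
  have h3 : Indep (MeasurableSpace.comap (fun ω => (z t ω).coeff) inferInstance)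
      (MeasurableSpace.comap id m) P := h1.congr h2 (.refl _ _)
  rw [MeasurableSpace.comap_id] at h3
  have h4 : MeasurableSpace.comap (z t) inferInstance
      = MeasurableSpace.comap (fun ω => (z t ω).coeff) inferInstance :=
    MeasurableSpace.comap_comp
  rw [h4]
  exact h3

/-! ### Square summability and Hölder–Besov regularity -/

namespace Distr

lemma memL2_iff_summable (u : Distr) : u.MemL2 ↔ Summable fun k => ‖u.coeff k‖ ^ 2 := by
  constructor
  · rintro ⟨f, -, hf⟩
    have h := (hasSum_sq_fourierCoeff f).summable.comp_injective
      (Subtype.val_injective (p := (· ≠ 0)))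
    exact h.congr fun k => by rw [Function.comp_apply, hf]
  · intro h
    let c : ℤ → ℂ := fun n => if hn : n ≠ 0 then u.coeff ⟨n, hn⟩ else 0
    have hc : Summable fun n => ‖c n‖ ^ 2 := by
      have hinj : Function.Injective (Subtype.val : Mode → ℤ) := Subtype.val_injective
      refine (hinj.summable_iff fun n hn => ?_).1 (h.congr fun k => ?_)
      · have : n = 0 := by
          by_contra h0
          exact hn ⟨⟨n, h0⟩, rfl⟩
        simp [c, this]
      · simp [c, k.2]
    have hmem : Memℓp c 2 := by
      rw [memℓp_gen_iff (by norm_num)]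
      simpa using hc
    refine ⟨fourierBasis.repr.symm ⟨c, hmem⟩, ?_, fun k => ?_⟩
    · rw [← fourierBasis_repr, LinearIsometryEquiv.apply_symm_apply]
      simp [c]
    · rw [← fourierBasis_repr, LinearIsometryEquiv.apply_symm_apply]
      simp [c, k.2]

lemma memL2_powA_iff (u : Distr) (δ : ℝ) :
    (u.powA δ).MemL2 ↔ Summable fun k => eig k ^ (2 * δ) * ‖u.coeff k‖ ^ 2 := by
  rw [memL2_iff_summable]
  refine summable_congr fun k => ?_
  change ‖((eig k ^ δ : ℝ) : ℂ) * u.coeff k‖ ^ 2 = _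
  rw [norm_mul, mul_pow, Complex.norm_real, Real.norm_eq_abs, sq_abs, ← Real.rpow_natCast,
    ← Real.rpow_mul (eig_nonneg k), mul_comm δ]
  norm_num

lemma eig_rpow (k : Mode) (δ : ℝ) : eig k ^ δ = |(k.1 : ℝ)| ^ (2 * δ) := by
  rw [Real.rpow_mul (abs_nonneg _), eig, ← sq_abs]
  norm_num

lemma IsSmooth.summable {u : Distr} (hu : u.IsSmooth) (δ : ℝ) :
    Summable fun k => eig k ^ δ * ‖u.coeff k‖ ^ 2 := by
  obtain ⟨N, hN⟩ := exists_nat_ge (δ + 1)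
  obtain ⟨C, hC⟩ := hu N
  have h1 : Summable fun k : Mode => C ^ 2 * (1 / ((k.1 : ℤ) : ℝ) ^ 2) :=
    ((Real.summable_one_div_int_pow.2 one_lt_two).comp_injective
      (Subtype.val_injective (p := (· ≠ 0)))).mul_left _
  refine Summable.of_nonneg_of_le
    (fun k => mul_nonneg (Real.rpow_nonneg (eig_nonneg k) _) (sq_nonneg _)) (fun k => ?_) h1
  have h2 : eig k ^ δ * eig k ≤ (1 + |(k.1 : ℝ)|) ^ (2 * N) := by
    rw [← Real.rpow_add_one (eig_pos k).ne']
    calc eig k ^ (δ + 1) ≤ eig k ^ (N : ℝ) := Real.rpow_le_rpow_of_exponent_le (one_le_eig k) hN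
      _ = |(k.1 : ℝ)| ^ (2 * N) := by rw [Real.rpow_natCast, eig, ← sq_abs, pow_mul]
      _ ≤ _ := pow_le_pow_left₀ (abs_nonneg _) (by linarith) _
  have h3 : (1 + |(k.1 : ℝ)|) ^ (2 * N) * ‖u.coeff k‖ ^ 2 ≤ C ^ 2 := by
    have := pow_le_pow_left₀ (by positivity) (hC k) 2
    rwa [mul_pow, ← pow_mul, mul_comm N] at this
  have h4 : eig k ^ δ * eig k * ‖u.coeff k‖ ^ 2 ≤ C ^ 2 :=
    (mul_le_mul_of_nonneg_right h2 (sq_nonneg _)).trans h3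
  rw [mul_one_div]
  change _ ≤ C ^ 2 / eig k
  rw [le_div_iff₀ (eig_pos k)]
  linarith

end Distr

namespace DyadicPartition

variable (D : DyadicPartition)

/-- The frequencies `k` seen by the block with index `n` satisfy `|k| ~ 2^n`. -/
lemma exists_support_bounds : ∃ a b : ℝ, 0 < a ∧ ∀ (n : ℕ) (k : Mode),
    dyadicSymbol D.χ D.φ n k.1 ≠ 0 → a * 2 ^ n ≤ |(k.1 : ℝ)| ∧ |(k.1 : ℝ)| ≤ b * 2 ^ n := by
  obtain ⟨R, hR, hχ⟩ := D.support_χ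
  obtain ⟨a, b, ha, hab, hφ⟩ := D.support_φ
  refine ⟨min 1 (a / 2), max R b, by positivity, fun n k hn => ?_⟩
  have hk := one_le_abs_mode k
  cases n with
  | zero =>
    have h1 : |(k.1 : ℝ)| ≤ R := hχ (subset_tsupport _ hn)
    rw [pow_zero, mul_one, mul_one]
    exact ⟨(min_le_left _ _).trans hk, h1.trans (le_max_left _ _)⟩
  | succ j =>
    have h1 := hφ (subset_tsupport _ hn)
    have h2 : |(2 : ℝ) ^ (-(j : ℝ)) * k.1| = |(k.1 : ℝ)| / 2 ^ j := by
      rw [abs_mul, abs_of_pos (by positivity), Real.rpow_neg zero_le_two, Real.rpow_natCast]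
      ring
    rw [Set.mem_ofPred_eq, h2, le_div_iff₀ (by positivity), div_le_iff₀ (by positivity)] at h1
    have h3 : (0 : ℝ) < 2 ^ j := by positivity
    have h4 := min_le_right 1 (a / 2)
    have h5 := le_max_right R b
    have h6 : 0 < b := ha.trans hab
    rw [pow_succ]
    constructor <;> nlinarith

lemma dyadicSymbol_mem (n : ℕ) (ξ : ℝ) : dyadicSymbol D.χ D.φ n ξ ∈ Set.Icc (0 : ℝ) 1 := by
  cases n with
  | zero => exact D.χ_mem ξ
  | succ j => exact D.φ_mem _

/-- At most two neighbouring symbols are nonzero at a given point, so one of them is at least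
`1/2`. -/
lemma exists_half_le (ξ : ℝ) : ∃ n, 1 / 2 ≤ dyadicSymbol D.χ D.φ n ξ := by
  by_contra! hlt
  set s : ℕ → ℝ := fun n => dyadicSymbol D.χ D.φ n ξ with hs
  have hsum : HasSum s 1 := by
    rw [← hasSum_nat_add_iff' 1]
    simpa [hs, dyadicSymbol] using D.partition ξ
  have hex : ∃ n, s n ≠ 0 := by
    by_contra! h
    rw [funext h] at hsum
    exact zero_ne_one (hasSum_zero.unique hsum)
  classical
  set n := Nat.find hex with hn
  have hzero : ∀ i ∉ ({n, n + 1} : Finset ℕ), s i = 0 := by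
    intro i hi
    simp only [Finset.mem_insert, Finset.mem_singleton, not_or] at hi
    rcases lt_or_ge i n with h | h
    · by_contra h'
      exact Nat.find_min hex h h'
    · have hni : n + 1 < i := by omega
      by_contra h'
      exact Set.disjoint_left.1 (D.disjoint n i hni) (subset_tsupport _ (Nat.find_spec hex))
        (subset_tsupport _ h')
  have h2 := hsum.unique (hasSum_sum_of_ne_finset_zero hzero)
  rw [Finset.sum_pair (by omega)] at h2
  have h3 := hlt n
  have h4 := hlt (n + 1)
  change s n < _ at h3
  change s (n + 1) < _ at h4
  linarith

/-- Parseval's identity for a Littlewood–Paley block, as an upper bound by the supremum norm. -/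
lemma sum_sq_le_of_block_le {n : ℕ} {u : Distr} {M : ℝ} (h : ∀ x, ‖block D n u x‖ ≤ M)
    (s : Finset Mode) :
    ∑ k ∈ s, (dyadicSymbol D.χ D.φ n k.1 * ‖u.coeff k‖) ^ 2 ≤ M ^ 2 := by
  classical
  obtain ⟨a, b, -, hab⟩ := D.exists_support_bounds
  have hfin : {k : Mode | dyadicSymbol D.χ D.φ n k.1 ≠ 0}.Finite := by
    have h1 : (Set.Icc (-⌈b * 2 ^ n⌉) ⌈b * 2 ^ n⌉ : Set ℤ).Finite := Set.finite_Icc _ _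
    refine (h1.preimage (Subtype.val_injective (p := (· ≠ 0))).injOn).subset fun k hk => ?_
    have h2 := abs_le.1 ((hab n k hk).2.trans (Int.le_ceil _))
    exact ⟨by exact_mod_cast h2.1, by exact_mod_cast h2.2⟩
  set S := hfin.toFinset ∪ s with hS
  set c : Mode → ℂ := fun k => ((dyadicSymbol D.χ D.φ n k.1 : ℝ) : ℂ) * u.coeff k with hc
  have hblock : ∀ x, block D n u x = ∑ k ∈ S, c k * fourier k.1 x := by
    intro x
    refine tsum_eq_sum fun k hk => ?_
    have h0 : dyadicSymbol D.χ D.φ n k.1 = 0 := by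
      by_contra h0
      exact hk (Finset.mem_union_left _ (hfin.mem_toFinset.2 h0))
    simp [h0]
  have hpars := integral_normSq_sum_fourier S c
  simp_rw [← hblock] at hpars
  have hle : ∫ x : Torus, ‖block D n u x‖ ^ 2 ≤ 2 * Real.pi * M ^ 2 := by
    have hM : ∫ _ : Torus, M ^ 2 = 2 * Real.pi * M ^ 2 := by
      rw [integral_const, measureReal_def, AddCircle.measure_univ,
        ENNReal.toReal_ofReal Real.two_pi_pos.le, smul_eq_mul]
    rw [← hM]
    refine integral_mono_of_nonneg (.of_forall fun x => sq_nonneg _) (integrable_const _)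
      (.of_forall fun x => pow_le_pow_left₀ (norm_nonneg _) (h x) 2)
  rw [hpars] at hle
  have h3 := le_of_mul_le_mul_left hle Real.two_pi_pos
  refine le_trans ?_ h3
  calc ∑ k ∈ s, (dyadicSymbol D.χ D.φ n k.1 * ‖u.coeff k‖) ^ 2
      = ∑ k ∈ s, ‖c k‖ ^ 2 := by
        refine Finset.sum_congr rfl fun k _ => ?_
        rw [hc, norm_mul, Complex.norm_real, Real.norm_of_nonneg (D.dyadicSymbol_mem n _).1]
    _ ≤ ∑ k ∈ S, ‖c k‖ ^ 2 :=
        Finset.sum_le_sum_of_subset_of_nonneg Finset.subset_union_right fun _ _ _ => sq_nonneg _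

/-- `B^γ_{∞,∞}` is contained in the Sobolev space `H^a` for every `a < γ`. -/
lemma summable_of_besovNorm_ne_top {γ a : ℝ} (ha : a < γ) {u : Distr}
    (hu : besovNorm D γ u ≠ ⊤) : Summable fun k => eig k ^ a * ‖u.coeff k‖ ^ 2 := by
  set B := (besovNorm D γ u).toReal with hB
  obtain ⟨c, d, hc, hcd⟩ := D.exists_support_bounds
  have hblock : ∀ n x, ‖block D n u x‖ ≤ B * (2 : ℝ) ^ (-(((n : ℝ) - 1) * γ)) := by
    intro n x
    have h1 : ENNReal.ofReal ((2 : ℝ) ^ (((n : ℝ) - 1) * γ) * ‖block D n u x‖) ≤ besovNorm D γ u :=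
      le_iSup₂_of_le n x le_rfl
    have h2 := (ENNReal.ofReal_le_iff_le_toReal hu).1 h1
    rw [Real.rpow_neg zero_le_two, ← div_eq_mul_inv, le_div_iff₀ (by positivity), mul_comm]
    exact h2
  -- on the support of the symbol with index `n`, `|k|^{2a}` is comparable with `2^{2an}`
  obtain ⟨L, hL, hLk⟩ : ∃ L : ℝ, 0 ≤ L ∧ ∀ (n : ℕ) (k : Mode), dyadicSymbol D.χ D.φ n k.1 ≠ 0 →
      eig k ^ a ≤ L * (2 : ℝ) ^ ((n : ℝ) * (2 * a)) := by
    refine ⟨max (c ^ (2 * a)) (|d| ^ (2 * a)), by positivity, fun n k hk => ?_⟩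
    obtain ⟨h1, h2⟩ := hcd n k hk
    have h3 : (2 : ℝ) ^ ((n : ℝ) * (2 * a)) = ((2 : ℝ) ^ n) ^ (2 * a) := by
      rw [Real.rpow_mul zero_le_two, Real.rpow_natCast]
    rw [Distr.eig_rpow, h3]
    have h4 : (0 : ℝ) < 2 ^ n := by positivity
    rcases le_total 0 a with h0 | h0
    · refine le_trans ?_ (mul_le_mul_of_nonneg_right (le_max_right _ _) (by positivity))
      rw [← Real.mul_rpow (abs_nonneg d) h4.le]
      refine Real.rpow_le_rpow (abs_nonneg _) (h2.trans ?_) (by positivity)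
      exact mul_le_mul_of_nonneg_right (le_abs_self d) h4.le
    · refine le_trans ?_ (mul_le_mul_of_nonneg_right (le_max_left _ _) (by positivity))
      rw [← Real.mul_rpow hc.le h4.le]
      exact Real.rpow_le_rpow_of_nonpos (by positivity) h1 (by linarith)
  set r : ℝ := (2 : ℝ) ^ (2 * (a - γ)) with hr
  have hr0 : 0 < r := by positivity
  have hr1 : r < 1 := Real.rpow_lt_one_of_one_lt_of_neg one_lt_two (by linarith)
  set M : ℝ := 4 * L * B ^ 2 * (2 : ℝ) ^ (2 * γ) with hM
  have hgeom : Summable fun n : ℕ => M * r ^ n :=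
    (summable_geometric_of_lt_one hr0.le hr1).mul_left _
  choose N hN using fun k : Mode => D.exists_half_le k.1
  refine summable_of_sum_le (c := ∑' n, M * r ^ n)
    (fun k => mul_nonneg (Real.rpow_nonneg (eig_nonneg k) _) (sq_nonneg _)) fun s => ?_
  classical
  rw [← Finset.sum_fiberwise_of_maps_to (t := s.image N) (g := N)
    fun k hk => Finset.mem_image_of_mem N hk]
  refine le_trans (Finset.sum_le_sum fun n _ => ?_)
    (hgeom.sum_le_tsum (s.image N) fun n _ => by positivity)
  have h5 := D.sum_sq_le_of_block_le (hblock n) (s.filter fun k => N k = n)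
  calc ∑ k ∈ s with N k = n, eig k ^ a * ‖u.coeff k‖ ^ 2
      ≤ ∑ k ∈ s with N k = n, 4 * L * (2 : ℝ) ^ ((n : ℝ) * (2 * a))
          * (dyadicSymbol D.χ D.φ n k.1 * ‖u.coeff k‖) ^ 2 := by
        refine Finset.sum_le_sum fun k hk => ?_
        have h6 := hN k
        rw [(Finset.mem_filter.1 hk).2] at h6
        have h7 := hLk n k (by linarith)
        have h8 : 1 ≤ 4 * dyadicSymbol D.χ D.φ n k.1 ^ 2 := by nlinarith
        calc eig k ^ a * ‖u.coeff k‖ ^ 2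
            ≤ (L * (2 : ℝ) ^ ((n : ℝ) * (2 * a))) * ‖u.coeff k‖ ^ 2 :=
              mul_le_mul_of_nonneg_right h7 (sq_nonneg _)
          _ ≤ (L * (2 : ℝ) ^ ((n : ℝ) * (2 * a))) * ‖u.coeff k‖ ^ 2
              * (4 * dyadicSymbol D.χ D.φ n k.1 ^ 2) := le_mul_of_one_le_right (by positivity) h8
          _ = _ := by ring
    _ ≤ 4 * L * (2 : ℝ) ^ ((n : ℝ) * (2 * a)) * (B * (2 : ℝ) ^ (-(((n : ℝ) - 1) * γ))) ^ 2 := by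
        rw [← Finset.mul_sum]
        exact mul_le_mul_of_nonneg_left h5 (by positivity)
    _ = M * r ^ n := by
        have h9 : ((2 : ℝ) ^ (-(((n : ℝ) - 1) * γ))) ^ 2
            = (2 : ℝ) ^ (2 * γ) * (2 : ℝ) ^ (-(2 * γ * n)) := by
          rw [← Real.rpow_natCast, ← Real.rpow_mul zero_le_two, ← Real.rpow_add two_pos]
          congr 1
          push_cast
          ring
        have h10 : r ^ n = (2 : ℝ) ^ ((n : ℝ) * (2 * a)) * (2 : ℝ) ^ (-(2 * γ * n)) := by
          rw [hr, ← Real.rpow_natCast, ← Real.rpow_mul zero_le_two, ← Real.rpow_add two_pos]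
          congr 1
          ring
        rw [mul_pow, h9, h10, hM]
        ring

end DyadicPartition

lemma MemHolder.memL2_powA {D : DyadicPartition} {γ β : ℝ} (hγ : 1 < γ + β) {u : Distr}
    (hu : MemHolder D γ u) : (u.powA ((1 - β) / 2)).MemL2 := by
  obtain ⟨g, hg, hlt⟩ := hu 1 one_pos
  rw [Distr.memL2_powA_iff]
  set a : ℝ := 2 * ((1 - β) / 2) with ha
  have h1 := D.summable_of_besovNorm_ne_top (a := a) (by rw [ha]; linarith) hlt.ne_top
  have h2 := hg.summable a
  refine Summable.of_nonneg_of_le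
    (fun k => mul_nonneg (Real.rpow_nonneg (eig_nonneg k) _) (sq_nonneg _)) (fun k => ?_)
    ((h1.add h2).mul_left 2)
  have h3 : u.coeff k = (u - g).coeff k + g.coeff k := by
    change _ = u.coeff k + -g.coeff k + g.coeff k
    ring
  have h4 : ‖u.coeff k‖ ^ 2 ≤ 2 * (‖(u - g).coeff k‖ ^ 2 + ‖g.coeff k‖ ^ 2) := by
    have h5 : ‖u.coeff k‖ ≤ ‖(u - g).coeff k‖ + ‖g.coeff k‖ := by
      conv_lhs => rw [h3]
      exact norm_add_le _ _
    exact (pow_le_pow_left₀ (norm_nonneg _) h5 2).trans (add_sq_le)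
  calc eig k ^ a * ‖u.coeff k‖ ^ 2 ≤ eig k ^ a * _ :=
        mul_le_mul_of_nonneg_left h4 (Real.rpow_nonneg (eig_nonneg k) _)
    _ = _ := by ring

end CameronMartin

open CameronMartin in
theorem theorem4p1 {Ω : Type*} [mΩ : MeasurableSpace Ω] (P : Measure Ω) [IsProbabilityMeasure P]
    (W : ℝ≥0 → L2Torus → Ω → ℝ) (hW : IsCylindricalBrownianMotion W P)
    (β : ℝ) (Ξ : NoiseOperator) (hΞ : Ξ.ApproxPower β)
    (z₀ : Distr) (z : ℝ≥0 → Ω → Distr) (hz : IsStochasticConvolution P W Ξ z₀ z)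
    (𝒢 : Filtration ℝ≥0 mΩ) (h𝒢 : ∀ s, Indep (𝒢 s) (sigmaNoise W) P)
    (F : ℝ≥0 → Ω → Distr)
    (hF : ∀ᵐ ω ∂P, ∀ k, Continuous fun s => (F s ω).coeff k)
    (h : ℝ≥0 → Ω → Distr) (hh : ∀ s, ∀ᵐ ω ∂P, IsDriftIntegral (fun r => F r ω) s (h s ω))
    (hadapted : ∀ s, Measurable[𝒢 s] (h s))
    (t : ℝ≥0) (ht : 0 < t) :
    ((∀ᵐ ω ∂P, ((h t ω).powA ((1 - β) / 2)).MemL2) →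
      CondLawEquivalent (𝒢 t) P (fun ω => z t ω + h t ω) (P.map (z t))) ∧
    (∀ (D : DyadicPartition) (γ : ℝ), 1 < γ + β → (∀ᵐ ω ∂P, MemHolder D γ (h t ω)) →
      (∀ᵐ ω ∂P, ((h t ω).powA ((1 - β) / 2)).MemL2) ∧
      CondLawEquivalent (𝒢 t) P (fun ω => z t ω + h t ω) (P.map (z t))) := by
  have hmain : (∀ᵐ ω ∂P, ((h t ω).powA ((1 - β) / 2)).MemL2) →
      CondLawEquivalent (𝒢 t) P (fun ω => z t ω + h t ω) (P.map (z t)) := by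
    intro hL2
    refine condLawEquivalent_of_indepFun (𝒢.le t) Distr.measurable_add (hz.measurable t)
      (hadapted t) (hz.indep hW (h𝒢 t) t) ?_
    filter_upwards [hL2] with ω hω
    rw [Distr.memL2_powA_iff, mul_div_cancel₀ _ two_ne_zero] at hω
    exact map_add_equivalent hW hΞ hz ht hω
  refine ⟨hmain, fun D γ hγ hHol => ?_⟩
  have hL2 : ∀ᵐ ω ∂P, ((h t ω).powA ((1 - β) / 2)).MemL2 :=
    hHol.mono fun ω hω => hω.memL2_powA hγ
  exact ⟨hL2, hmain hL2⟩
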